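/- Let $\mathscr W=\{w\in C([0,1];\mathbb R): w(0)=0\}$ with the topology of uniform convergence, its Borel $\sigma$-field and the Wiener measure $\gamma$; $E$ denotes expectation under $\gamma$. Let $\mathscr H\subset\mathscr W$ be the Cameron–Martin subspace of absolutely continuous $h$ with $\dot h\in L^2([0,1])$. For $h\in\mathscr H$ let $[h](w)=\int_0^1\dot h(t)\,dw(t)$ be the Wiener integral, taken in the following version: with $\dot h_n$ the step function equal on each interval $(k2^{-n},(k+1)2^{-n}]$, $0\le k<2^n$, to the average of $\dot h$ over that interval, $[h](w)=\lim_{n\to\infty}\int_0^1\dot h_n\,dw$ where this limit exists and $[h](w)=0$ elsewhere. Let $\mathbf P$ be the set of polynomial functionals $F(w)=p([h_1](w),\dots,[h_n](w))$, where $n\in\mathbb N$, $h_1,\dots,h_n\in\mathscr H$ and $p$ is a real polynomial in $n$ variables. For $\theta\in\mathscr H$ and $F:\mathscr W\to\mathbb R$ put $$D_\theta F(w)=\lim_{\varepsilon\to0}\frac{F(w+\varepsilon\theta)-F(w)}{\varepsilon},\qquad D_\theta^*F(w)=-D_\theta F(w)+[\theta](w)F(w),$$ and $e^{A}F(w)=\sum_{n\ge0}\frac1{n!}A^nF(w)$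 for $A=D_\theta$ or $A=D_\theta^*$. For every $h\in\mathscr H$, $[h]$ is a version of the Wiener integral, that is, of the $L^2(\gamma)$-limit of the integrals of step functions converging to $\dot h$ in $L^2([0,1])$. Moreover, for every $\theta\in\mathscr H$, all iterates $(D_\theta^*)^n1$ are defined on $\mathscr W$, and for $\gamma$-almost every $w\in\mathscr W$ the series defining $e^{D_\theta^*}1(w)$ converges and $$e^{D_\theta^*}1(w)=\exp\Big\{\int_0^1\dot\theta(t)\,dw(t)-\frac12\int_0^1\dot\theta(t)^2\,dt\Big\}.$$ Furthermore, for every $F\in\mathbf P$, all $D_\theta^nF$ are defined on $\mathscr W$, the series defining $e^{D_\theta}F$ converges everywhere, $e^{D_\theta}F$ and $F\cdot e^{D_\theta^*}1$ are $\gamma$-integrable, and $$E\big[e^{D_\theta}F\big]=E\big[F\cdot e^{D_\theta^*}1\big].$$ -/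

import Mathlib

open MeasureTheory ProbabilityTheory Filter Topology
open scoped ENNReal

noncomputable section

namespace WienerCM

/-- The space `𝒲` of continuous real paths on `[0,1]` starting from zero, with the topology of
uniform convergence. -/
def wienerSpace : Submodule ℝ C(unitInterval, ℝ) where
  carrier := {w | w 0 = 0}
  add_mem' := by
    intro a b ha hb
    simp only [Set.mem_ofPred_eq] at ha hb ⊢
    simp [ha, hb]
  zero_mem' := by simp
  smul_mem' := by
    intro c a ha
    simp only [Set.mem_ofPred_eq] at ha ⊢
    simp [ha]

instance : MeasurableSpace wienerSpace := borel wienerSpace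

instance : BorelSpace wienerSpace := ⟨rfl⟩

/-- The canonical process `W(t, w) = w(t)`. -/
def coord (t : unitInterval) (w : wienerSpace) : ℝ := (w : C(unitInterval, ℝ)) t

/-- A path on `[0,1]` seen as a function on `ℝ`, constant on each side of `[0,1]`. -/
def path (w : wienerSpace) : ℝ → ℝ :=
  Set.IccExtend (zero_le_one' ℝ) (w : C(unitInterval, ℝ))

/-- `γ` is the Wiener measure: under `γ` the canonical process has independent increments and
`W(t) - W(s)` has law `N(0, t - s)` for `s ≤ t`. (There is exactly one such measure.) -/
structure IsWienerMeasure (γ : Measure wienerSpace) : Prop where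
  isProbabilityMeasure : IsProbabilityMeasure γ
  indepIncrements : HasIndepIncrements coord γ
  law_increment : ∀ s t : unitInterval, s ≤ t →
    HasLaw (fun w => coord t w - coord s w)
      (gaussianReal 0 (Real.toNNReal ((t : ℝ) - (s : ℝ)))) γ

/-- The derivative `ḣ` of a path. -/
def pathDeriv (h : wienerSpace) : ℝ → ℝ := deriv (path h)

/-- The Cameron-Martin subspace `ℋ`: absolutely continuous paths with square-integrable
derivative. -/
def cameronMartin : Set wienerSpace :=
  {h | AbsolutelyContinuousOnInterval (path h) 0 1 ∧
    MemLp (pathDeriv h) 2 (volume.restrict (Set.Icc (0 : ℝ) 1))}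

/-- The step function `∑_{i<N} c_i 1_{(t_i, t_{i+1}]}`. -/
def stepFun (N : ℕ) (c t : ℕ → ℝ) (s : ℝ) : ℝ :=
  ∑ i ∈ Finset.range N, (Set.Ioc (t i) (t (i + 1))).indicator (fun _ => c i) s

/-- The integral `∑_{i<N} c_i (w(t_{i+1}) - w(t_i))` of that step function against `dw`. -/
def stepIntegral (N : ℕ) (c t : ℕ → ℝ) (w : wienerSpace) : ℝ :=
  ∑ i ∈ Finset.range N, c i * (path w (t (i + 1)) - path w (t i))

/-- `X` is (a version of) the Wiener integral `∫₀¹ f(t) dw(t)`: the limit in `L²(γ)` of the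
integrals of step functions that converge to `f` in `L²([0,1])`. -/
def IsWienerIntegral (γ : Measure wienerSpace) (f : ℝ → ℝ) (X : wienerSpace → ℝ) : Prop :=
  MemLp X 2 γ ∧ ∃ (N : ℕ → ℕ) (c t : ℕ → ℕ → ℝ),
    (∀ m, (∀ i ≤ N m, t m i ∈ Set.Icc (0 : ℝ) 1) ∧ ∀ i < N m, t m i ≤ t m (i + 1)) ∧
    Tendsto (fun m => eLpNorm (fun s => stepFun (N m) (c m) (t m) s - f s) 2
      (volume.restrict (Set.Icc (0 : ℝ) 1))) atTop (𝓝 0) ∧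
    Tendsto (fun m => eLpNorm (fun w => stepIntegral (N m) (c m) (t m) w - X w) 2 γ)
      atTop (𝓝 0)

/-- The integral against `dw` of the step function that on each dyadic interval
`(k/2ⁿ, (k+1)/2ⁿ]` of `[0,1]` equals the average of `f` there. -/
def dyadicIntegral (f : ℝ → ℝ) (n : ℕ) (w : wienerSpace) : ℝ :=
  stepIntegral (2 ^ n)
    (fun k => 2 ^ n * ∫ s in ((k : ℝ) / 2 ^ n)..(((k : ℝ) + 1) / 2 ^ n), f s)
    (fun k => (k : ℝ) / 2 ^ n) w

open Classical in
/-- The pathwise version of the Wiener integral `∫₀¹ f(t) dw(t)`: the limit of the integrals of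
the dyadic averages of `f` wherever it exists, and `0` elsewhere. For `f ∈ L²([0,1])` these
integrals form an `L²`-bounded martingale, so the limit exists almost surely and in `L²`. -/
def wienerIntegral (f : ℝ → ℝ) (w : wienerSpace) : ℝ :=
  if h : ∃ c : ℝ, Tendsto (fun n => dyadicIntegral f n w) atTop (𝓝 c) then h.choose else 0

/-- `[h](w) = ∫₀¹ ḣ(t) dw(t)`. -/
def bracket (h w : wienerSpace) : ℝ := wienerIntegral (pathDeriv h) w

/-- The polynomial functionals `w ↦ p([h₁](w), …, [hₙ](w))` with `h₁, …, hₙ ∈ ℋ`. -/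
def polyFunctionals : Set (wienerSpace → ℝ) :=
  {F | ∃ (n : ℕ) (h : Fin n → wienerSpace) (p : MvPolynomial (Fin n) ℝ),
    (∀ i, h i ∈ cameronMartin) ∧ ∀ w, F w = MvPolynomial.eval (fun i => bracket (h i) w) p}

/-- The limit defining `D_θ F(w)` exists. -/
def DirDerivExists (θ : wienerSpace) (F : wienerSpace → ℝ) (w : wienerSpace) : Prop :=
  DifferentiableAt ℝ (fun ε : ℝ => F (w + ε • θ)) 0

/-- `D_θ F(w) = lim_{ε → 0} (F(w + εθ) - F(w)) / ε`. -/
def dirDeriv (θ : wienerSpace) (F : wienerSpace → ℝ) : wienerSpace → ℝ :=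
  fun w => deriv (fun ε : ℝ => F (w + ε • θ)) 0

/-- `D_θ^* F(w) = -D_θ F(w) + [θ](w) F(w)`. -/
def dirDerivAdj (θ : wienerSpace) (F : wienerSpace → ℝ) : wienerSpace → ℝ :=
  fun w => -dirDeriv θ F w + bracket θ w * F w

/-- The terms `(1/n!) Aⁿ F(w)` of the exponential series of an operator `A`. -/
def expTerm (A : (wienerSpace → ℝ) → wienerSpace → ℝ) (F : wienerSpace → ℝ) (w : wienerSpace)
    (n : ℕ) : ℝ :=
  ((n.factorial : ℝ))⁻¹ * (A^[n] F) w

/-- `e^A F(w) = ∑ₙ (1/n!) Aⁿ F(w)`. -/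
def expOp (A : (wienerSpace → ℝ) → wienerSpace → ℝ) (F : wienerSpace → ℝ) : wienerSpace → ℝ :=
  fun w => ∑' n, expTerm A F w n

end WienerCM

end

noncomputable section

namespace WienerCM

/-! On `cameronMartin`, the pathwise bracket is affine along shifts. If `θ` is absolutely
continuous, the dyadic integral of `pathDeriv h` evaluated at `θ` itself is the inner product of the
dyadic averages of the two derivatives, and it converges to their `L²` inner product. So the set
where the dyadic integrals converge is invariant under `w ↦ w + ε • θ`, and `bracket_add_smul` holds
for every `w`: the slope `bracketDeriv` is that inner product on the set and `0` off it, and it does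
not change along the line.

The two exponentials then become pointwise algebra. Iterating the adjoint on `1` yields Hermite
polynomials in `bracket θ w` with variance `bracketDeriv θ θ w`, and their generating function at
`1` is the exponential (`hasSum_hermiteVar`). A polynomial functional is a polynomial in `ε` along
each line, so its exponential series is a finite Taylor expansion with sum `F (w + θ)`
(`hasSum_expTerm_of_polynomial`).

What remains is the Cameron–Martin formula for finitely many Wiener integrals
(`map_shiftedMeasure`). Completing the square gives equality of the moment generating functions of
each linear combination; analytic continuation turns it into equality of characteristic functions.

The probabilistic input is the almost sure convergence of the dyadic integrals. They are jointly
Gaussian, and the isometry (`covariance_stepIntegral`) shows that their increments are uncorrelated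
with, hence independent of, the past. They therefore form an `L²`-bounded martingale, whose limit is
Gaussian with variance `∫ f²`. -/

/-! ### Dyadic averages of a square-integrable function -/

/-- The average of `f` over the dyadic interval `(k/2ⁿ, (k+1)/2ⁿ]`. -/
def dyadicAvg (f : ℝ → ℝ) (n k : ℕ) : ℝ :=
  2 ^ n * ∫ s in ((k : ℝ) / 2 ^ n)..(((k : ℝ) + 1) / 2 ^ n), f s

/-- The inner product in `L²([0,1])` of the dyadic averages of `f` and `g`. -/
def dyadicInner (f g : ℝ → ℝ) (n : ℕ) : ℝ :=
  ∑ k ∈ Finset.range (2 ^ n), dyadicAvg f n k * dyadicAvg g n k / 2 ^ n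

/-- Square-integrability on `[0,1]`. -/
abbrev MemL2 (f : ℝ → ℝ) : Prop := MemLp f 2 (volume.restrict (Set.Icc (0 : ℝ) 1))

lemma dyadic_mem_Icc {n k : ℕ} (hk : k ≤ 2 ^ n) : (k : ℝ) / 2 ^ n ∈ Set.Icc (0 : ℝ) 1 := by
  refine ⟨by positivity, ?_⟩
  rw [div_le_one (by positivity)]
  exact_mod_cast hk

lemma monotone_dyadic (n : ℕ) : Monotone fun k : ℕ => (k : ℝ) / 2 ^ n := by
  intro a b hab
  have : (a : ℝ) ≤ b := by exact_mod_cast hab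
  dsimp only
  gcongr

lemma IntervalIntegrable.mono_Icc {f : ℝ → ℝ} (hf : IntervalIntegrable f volume 0 1) {a b : ℝ}
    (ha : a ∈ Set.Icc (0 : ℝ) 1) (hb : b ∈ Set.Icc (0 : ℝ) 1) :
    IntervalIntegrable f volume a b := by
  refine hf.mono_set ?_
  rw [Set.uIcc_of_le zero_le_one]
  exact Set.uIcc_subset_Icc ha hb

lemma MemL2.intervalIntegrable {f : ℝ → ℝ} (hf : MemL2 f) : IntervalIntegrable f volume 0 1 := by
  rw [intervalIntegrable_iff_integrableOn_Icc_of_le zero_le_one]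
  exact hf.integrable one_le_two

lemma MemL2.intervalIntegrable_mul {f g : ℝ → ℝ} (hf : MemL2 f) (hg : MemL2 g) :
    IntervalIntegrable (fun s => f s * g s) volume 0 1 := by
  rw [intervalIntegrable_iff_integrableOn_Icc_of_le zero_le_one]
  exact hf.integrable_mul hg

lemma MemL2.intervalIntegrable_sq {f : ℝ → ℝ} (hf : MemL2 f) :
    IntervalIntegrable (fun s => f s ^ 2) volume 0 1 := by
  simpa [sq] using hf.intervalIntegrable_mul hf

lemma eLpNorm_two_eq {α : Type*} {m : MeasurableSpace α} {μ : Measure α} {u : α → ℝ}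
    (hu : MemLp u 2 μ) : eLpNorm u 2 μ = ENNReal.ofReal (√(∫ x, u x ^ 2 ∂μ)) := by
  rw [hu.eLpNorm_eq_integral_rpow_norm (by simp) (by simp), Real.sqrt_eq_rpow]
  simp

lemma integral_Icc_eq_interval (f : ℝ → ℝ) :
    ∫ x in Set.Icc (0 : ℝ) 1, f x = ∫ x in (0 : ℝ)..1, f x := by
  rw [intervalIntegral.integral_of_le zero_le_one, integral_Icc_eq_integral_Ioc]

lemma integral_dyadic_add {f : ℝ → ℝ} (hf : IntervalIntegrable f volume 0 1) {n i j : ℕ}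
    (hij : i ≤ j) (hj : j ≤ 2 ^ n) :
    ∑ k ∈ Finset.Ico i j, ∫ s in ((k : ℝ) / 2 ^ n)..(((k : ℝ) + 1) / 2 ^ n), f s
      = ∫ s in ((i : ℝ) / 2 ^ n)..((j : ℝ) / 2 ^ n), f s := by
  have := intervalIntegral.sum_integral_adjacent_intervals_Ico (f := f) (μ := volume)
    (a := fun k : ℕ => (k : ℝ) / 2 ^ n) hij (fun k hk => ?_)
  · simpa using this
  · exact IntervalIntegrable.mono_Icc hf (dyadic_mem_Icc (by have := hk.2; omega))
      (dyadic_mem_Icc (by have := hk.2; omega))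

lemma integral_eq_sum_dyadic {f : ℝ → ℝ} (hf : IntervalIntegrable f volume 0 1) (n : ℕ) :
    ∫ s in (0 : ℝ)..1, f s = ∑ k ∈ Finset.range (2 ^ n),
      ∫ s in ((k : ℝ) / 2 ^ n)..(((k : ℝ) + 1) / 2 ^ n), f s := by
  have := integral_dyadic_add hf (n := n) (i := 0) (j := 2 ^ n) (Nat.zero_le _) le_rfl
  rw [Finset.range_eq_Ico, this]
  simp

lemma stepFun_of_mem {N : ℕ} {c t : ℕ → ℝ} (ht : Monotone t) {k : ℕ} (hk : k < N) {s : ℝ}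
    (hs : s ∈ Set.Ioc (t k) (t (k + 1))) : stepFun N c t s = c k := by
  unfold stepFun
  rw [Finset.sum_eq_single_of_mem k (Finset.mem_range.2 hk)]
  · simp [hs]
  · intro j _ hjk
    refine Set.indicator_of_notMem (fun h => ?_) _
    rcases lt_or_gt_of_ne hjk with h' | h'
    · exact absurd (ht (Nat.succ_le_of_lt h')) (not_le.2 (hs.1.trans_le h.2))
    · exact absurd (ht (Nat.succ_le_of_lt h')) (not_le.2 (h.1.trans_le hs.2))

lemma memLp_stepFun (N : ℕ) (c t : ℕ → ℝ) : MemL2 (stepFun N c t) := by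
  unfold stepFun
  exact memLp_finsetSum _ fun i _ =>
    memLp_indicator_const 2 measurableSet_Ioc _ (Or.inr (measure_ne_top _ _))

lemma integral_congr_dyadic {f g : ℝ → ℝ} {n k : ℕ}
    (h : ∀ s ∈ Set.Ioc ((k : ℝ) / 2 ^ n) (((k : ℝ) + 1) / 2 ^ n), f s = g s) :
    ∫ s in ((k : ℝ) / 2 ^ n)..(((k : ℝ) + 1) / 2 ^ n), f s
      = ∫ s in ((k : ℝ) / 2 ^ n)..(((k : ℝ) + 1) / 2 ^ n), g s := by
  refine intervalIntegral.integral_congr_ae (ae_of_all _ fun s hs => h s ?_)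
  rwa [Set.uIoc_of_le (by gcongr; linarith)] at hs

/-- The dyadic step function with values `c k`. -/
abbrev dyadicStep (c : ℕ → ℝ) (n : ℕ) : ℝ → ℝ :=
  stepFun (2 ^ n) c fun k => (k : ℝ) / 2 ^ n

lemma dyadicStep_of_mem (c : ℕ → ℝ) {n k : ℕ} (hk : k < 2 ^ n) {s : ℝ}
    (hs : s ∈ Set.Ioc ((k : ℝ) / 2 ^ n) (((k : ℝ) + 1) / 2 ^ n)) : dyadicStep c n s = c k :=
  stepFun_of_mem (monotone_dyadic n) hk (by simpa using hs)

lemma integral_dyadicStep (c : ℕ → ℝ) {n k : ℕ} (hk : k < 2 ^ n) :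
    ∫ s in ((k : ℝ) / 2 ^ n)..(((k : ℝ) + 1) / 2 ^ n), dyadicStep c n s = c k / 2 ^ n := by
  rw [integral_congr_dyadic (g := fun _ => c k) fun s hs => dyadicStep_of_mem c hk hs]
  simp only [intervalIntegral.integral_const, smul_eq_mul]
  ring

/-- Pythagoras: the averages are the orthogonal projection of `f` onto dyadic step functions. The
case where `c` is the averages gives the exact error, and the last sum measures the distance from
the optimum. -/
lemma integral_sub_dyadicStep_sq {f : ℝ → ℝ} (hf : MemL2 f) (c : ℕ → ℝ) (n : ℕ) :
    ∫ s in (0 : ℝ)..1, (f s - dyadicStep c n s) ^ 2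
      = (∫ s in (0 : ℝ)..1, f s ^ 2) - dyadicInner f f n
        + ∑ k ∈ Finset.range (2 ^ n), (c k - dyadicAvg f n k) ^ 2 / 2 ^ n := by
  have h1 : IntervalIntegrable (fun s => (f s - dyadicStep c n s) ^ 2) volume 0 1 :=
    MemL2.intervalIntegrable_sq (hf.sub (memLp_stepFun _ _ _))
  rw [integral_eq_sum_dyadic h1 n, integral_eq_sum_dyadic hf.intervalIntegrable_sq n, dyadicInner,
    ← Finset.sum_sub_distrib, ← Finset.sum_add_distrib]
  refine Finset.sum_congr rfl fun k hk => ?_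
  have hk' := Finset.mem_range.1 hk
  have m1 := dyadic_mem_Icc hk'.le
  have m2 : ((k : ℝ) + 1) / 2 ^ n ∈ Set.Icc (0 : ℝ) 1 := by
    simpa using dyadic_mem_Icc (n := n) (k := k + 1) hk'
  have i1 := IntervalIntegrable.mono_Icc hf.intervalIntegrable_sq m1 m2
  have i2 := IntervalIntegrable.mono_Icc hf.intervalIntegrable m1 m2
  rw [integral_congr_dyadic (g := fun s => f s ^ 2 - (2 * c k * f s - c k ^ 2)) fun s hs => by
    rw [dyadicStep_of_mem c hk' hs]; ring]
  rw [intervalIntegral.integral_sub i1 ((i2.const_mul _).sub (by simp)),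
    intervalIntegral.integral_sub (i2.const_mul _) (by simp), intervalIntegral.integral_const_mul]
  simp only [intervalIntegral.integral_const, smul_eq_mul, dyadicAvg]
  have : (2 : ℝ) ^ n ≠ 0 := by positivity
  field_simp
  ring

lemma integral_sub_dyadicAvg_sq {f : ℝ → ℝ} (hf : MemL2 f) (n : ℕ) :
    ∫ s in (0 : ℝ)..1, (f s - dyadicStep (dyadicAvg f n) n s) ^ 2
      = (∫ s in (0 : ℝ)..1, f s ^ 2) - dyadicInner f f n := by
  simp [integral_sub_dyadicStep_sq hf]

lemma dyadicInner_self_le {f : ℝ → ℝ} (hf : MemL2 f) (n : ℕ) :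
    dyadicInner f f n ≤ ∫ s in (0 : ℝ)..1, f s ^ 2 := by
  rw [← sub_nonneg, ← integral_sub_dyadicAvg_sq hf]
  exact intervalIntegral.integral_nonneg zero_le_one fun s _ => sq_nonneg _

lemma eLpNorm_sub_dyadicAvg_le {f : ℝ → ℝ} (hf : MemL2 f) (c : ℕ → ℝ) (n : ℕ) :
    eLpNorm (f - dyadicStep (dyadicAvg f n) n) 2 (volume.restrict (Set.Icc (0 : ℝ) 1))
      ≤ eLpNorm (f - dyadicStep c n) 2 (volume.restrict (Set.Icc (0 : ℝ) 1)) := by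
  rw [eLpNorm_two_eq (hf.sub (memLp_stepFun _ _ _)), eLpNorm_two_eq (hf.sub (memLp_stepFun _ _ _))]
  refine ENNReal.ofReal_le_ofReal (Real.sqrt_le_sqrt ?_)
  simp only [integral_Icc_eq_interval, Pi.sub_apply]
  rw [integral_sub_dyadicAvg_sq hf, integral_sub_dyadicStep_sq hf, le_add_iff_nonneg_right]
  positivity

lemma exists_mem_Ioc_dyadic {s : ℝ} (hs : s ∈ Set.Ioc (0 : ℝ) 1) (n : ℕ) :
    ∃ k : ℕ, k < 2 ^ n ∧ s ∈ Set.Ioc ((k : ℝ) / 2 ^ n) (((k : ℝ) + 1) / 2 ^ n) := by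
  have hp : (0 : ℝ) < 2 ^ n := by positivity
  have hs0 : 0 < s * 2 ^ n := mul_pos hs.1 hp
  have hc : 0 < ⌈s * 2 ^ n⌉₊ := Nat.ceil_pos.2 hs0
  obtain ⟨k, hk⟩ := Nat.exists_eq_add_of_lt hc
  simp only [zero_add] at hk
  have h1 : ⌈s * 2 ^ n⌉₊ ≤ 2 ^ n := by
    apply Nat.ceil_le.2
    push_cast
    nlinarith [hs.2]
  refine ⟨k, by omega, ?_, ?_⟩
  · rw [div_lt_iff₀ hp]
    exact Nat.lt_ceil.1 (by omega)
  · rw [le_div_iff₀ hp]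
    have := Nat.le_ceil (s * 2 ^ n)
    rw [hk] at this
    exact_mod_cast this

lemma tendsto_eLpNorm_continuous_sub_dyadicStep {g : ℝ → ℝ} (hg : Continuous g) :
    Tendsto (fun n : ℕ => eLpNorm (g - dyadicStep (fun k => g ((k : ℝ) / 2 ^ n)) n) 2
      (volume.restrict (Set.Icc (0 : ℝ) 1))) atTop (𝓝 0) := by
  rw [ENNReal.tendsto_nhds_zero]
  intro ε hε
  obtain ⟨δ, hδ0, hδ⟩ : ∃ δ : ℝ, 0 < δ ∧ ENNReal.ofReal δ ≤ ε := by
    rcases eq_or_ne ε ⊤ with rfl | h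
    · exact ⟨1, one_pos, le_top⟩
    · exact ⟨ε.toReal, ENNReal.toReal_pos hε.ne' h, ENNReal.ofReal_toReal_le⟩
  have huc := isCompact_Icc.uniformContinuousOn_of_continuous
    (hg.continuousOn (s := Set.Icc (0 : ℝ) 1))
  obtain ⟨η, hη0, hη⟩ := Metric.uniformContinuousOn_iff.1 huc δ hδ0
  obtain ⟨n₀, hn₀⟩ := exists_pow_lt_of_lt_one hη0 (by norm_num : (1 / 2 : ℝ) < 1)
  filter_upwards [eventually_ge_atTop n₀] with n hn
  have hn' : (1 / 2 : ℝ) ^ n < η :=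
    (pow_le_pow_of_le_one (by norm_num) (by norm_num) hn).trans_lt hn₀
  refine (eLpNorm_le_of_ae_bound (C := δ) ?_).trans (by simpa using hδ)
  rw [← restrict_Ioc_eq_restrict_Icc, ae_restrict_iff' measurableSet_Ioc]
  refine ae_of_all _ fun s hs => ?_
  obtain ⟨k, hk, hks⟩ := exists_mem_Ioc_dyadic hs n
  rw [Pi.sub_apply, dyadicStep_of_mem _ hk hks, ← dist_eq_norm]
  refine (hη _ (Set.Ioc_subset_Icc_self hs) _ (dyadic_mem_Icc hk.le) ?_).le
  rw [Real.dist_eq, abs_of_nonneg (by linarith [hks.1])]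
  have h2 := hks.2
  rw [add_div] at h2
  rw [one_div_pow] at hn'
  linarith

/-- Since the averages are the best dyadic approximation, it suffices to approximate `f` by a
continuous `g` and sample `g` at left endpoints. -/
lemma tendsto_eLpNorm_dyadicStep_sub {f : ℝ → ℝ} (hf : MemL2 f) :
    Tendsto (fun n : ℕ => eLpNorm (f - dyadicStep (dyadicAvg f n) n) 2
      (volume.restrict (Set.Icc (0 : ℝ) 1))) atTop (𝓝 0) := by
  rw [ENNReal.tendsto_nhds_zero]
  intro ε hε
  have hε2 : ε / 2 ≠ 0 := by simpa using hε.ne'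
  obtain ⟨g, -, hg1, hgc, hg2⟩ := hf.exists_hasCompactSupport_eLpNorm_sub_le (by simp) hε2
  have := ENNReal.tendsto_nhds_zero.1 (tendsto_eLpNorm_continuous_sub_dyadicStep hgc) (ε / 2)
    (pos_iff_ne_zero.2 hε2)
  filter_upwards [this] with n hn
  refine (eLpNorm_sub_dyadicAvg_le hf (fun k => g ((k : ℝ) / 2 ^ n)) n).trans ?_
  rw [← sub_add_sub_cancel f g]
  refine (eLpNorm_add_le (hf.sub hg2).1 (hg2.sub (memLp_stepFun _ _ _)).1 one_le_two).trans ?_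
  calc _ ≤ ε / 2 + ε / 2 := add_le_add hg1 hn
    _ = ε := ENNReal.add_halves ε

lemma tendsto_dyadicInner_self {f : ℝ → ℝ} (hf : MemL2 f) :
    Tendsto (dyadicInner f f) atTop (𝓝 (∫ s in (0 : ℝ)..1, f s ^ 2)) := by
  have h := tendsto_eLpNorm_dyadicStep_sub hf
  have h2 := (ENNReal.tendsto_toReal ENNReal.zero_ne_top).comp h
  have h3 : Tendsto (fun n => (∫ s in (0 : ℝ)..1, f s ^ 2) - dyadicInner f f n) atTop (𝓝 0) := by
    have h4 := h2.pow 2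
    simp only [ENNReal.toReal_zero, ne_eq, OfNat.ofNat_ne_zero, not_false_eq_true, zero_pow] at h4
    refine h4.congr fun n => ?_
    simp only [Function.comp_apply]
    rw [eLpNorm_two_eq (hf.sub (memLp_stepFun _ _ _)), ENNReal.toReal_ofReal (Real.sqrt_nonneg _),
      Real.sq_sqrt (integral_nonneg fun _ => sq_nonneg _)]
    simp only [integral_Icc_eq_interval, Pi.sub_apply]
    exact integral_sub_dyadicAvg_sq hf n
  have h5 := h3.const_sub (∫ s in (0 : ℝ)..1, f s ^ 2)
  rw [sub_zero] at h5
  exact h5.congr fun n => sub_sub_cancel _ _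

lemma dyadicAvg_add {f g : ℝ → ℝ} (hf : MemL2 f) (hg : MemL2 g) {n k : ℕ} (hk : k < 2 ^ n) :
    dyadicAvg (fun s => f s + g s) n k = dyadicAvg f n k + dyadicAvg g n k := by
  have m1 := dyadic_mem_Icc hk.le
  have m2 : ((k : ℝ) + 1) / 2 ^ n ∈ Set.Icc (0 : ℝ) 1 := by
    simpa using dyadic_mem_Icc (n := n) (k := k + 1) hk
  rw [dyadicAvg, intervalIntegral.integral_add
    (IntervalIntegrable.mono_Icc hf.intervalIntegrable m1 m2)
    (IntervalIntegrable.mono_Icc hg.intervalIntegrable m1 m2), mul_add]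
  rfl

lemma dyadicAvg_const_mul (a : ℝ) (f : ℝ → ℝ) (n k : ℕ) :
    dyadicAvg (fun s => a * f s) n k = a * dyadicAvg f n k := by
  rw [dyadicAvg, intervalIntegral.integral_const_mul, dyadicAvg]
  ring

/-- Polarization of `tendsto_dyadicInner_self`. -/
lemma tendsto_dyadicInner {f g : ℝ → ℝ} (hf : MemL2 f) (hg : MemL2 g) :
    Tendsto (dyadicInner f g) atTop (𝓝 (∫ s in (0 : ℝ)..1, f s * g s)) := by
  have hsum : MemL2 fun s => f s + g s := hf.add hg
  have h := (((tendsto_dyadicInner_self hsum).sub (tendsto_dyadicInner_self hf)).sub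
    (tendsto_dyadicInner_self hg)).div_const 2
  have e : ((∫ s in (0 : ℝ)..1, (f s + g s) ^ 2) - (∫ s in (0 : ℝ)..1, f s ^ 2)
      - ∫ s in (0 : ℝ)..1, g s ^ 2) / 2 = ∫ s in (0 : ℝ)..1, f s * g s := by
    rw [← intervalIntegral.integral_sub hsum.intervalIntegrable_sq hf.intervalIntegrable_sq,
      ← intervalIntegral.integral_sub
        (hsum.intervalIntegrable_sq.sub hf.intervalIntegrable_sq) hg.intervalIntegrable_sq,
      ← intervalIntegral.integral_div]
    congr 1
    ext s
    ring
  rw [e] at h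
  refine h.congr fun n => ?_
  simp only [dyadicInner, ← Finset.sum_sub_distrib, Finset.sum_div]
  refine Finset.sum_congr rfl fun k hk => ?_
  rw [dyadicAvg_add hf hg (Finset.mem_range.1 hk)]
  ring

/-- Tower property of averaging: a coarse cell is a union of fine cells, so averaging first on the
fine ones loses nothing. This is what makes the dyadic integrals a martingale. -/
lemma integral_dyadicStep_avg {f : ℝ → ℝ} (hf : MemL2 f) {m n j : ℕ} (hmn : m ≤ n)
    (hj : j < 2 ^ m) :
    ∫ s in ((j : ℝ) / 2 ^ m)..(((j : ℝ) + 1) / 2 ^ m), dyadicStep (dyadicAvg f n) n s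
      = dyadicAvg f m j / 2 ^ m := by
  obtain ⟨d, rfl⟩ := Nat.exists_eq_add_of_le hmn
  have e1 : (j : ℝ) / 2 ^ m = ((j * 2 ^ d : ℕ) : ℝ) / 2 ^ (m + d) := by
    push_cast
    rw [pow_add]
    field_simp
  have e2 : ((j : ℝ) + 1) / 2 ^ m = (((j + 1) * 2 ^ d : ℕ) : ℝ) / 2 ^ (m + d) := by
    push_cast
    rw [pow_add]
    field_simp
  have hle : (j + 1) * 2 ^ d ≤ 2 ^ (m + d) := by
    rw [pow_add]
    exact Nat.mul_le_mul_right _ hj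
  have hle' : j * 2 ^ d ≤ (j + 1) * 2 ^ d := Nat.mul_le_mul_right _ (Nat.le_succ j)
  rw [dyadicAvg, mul_div_assoc, mul_div_cancel₀ _ (by positivity : (2 : ℝ) ^ m ≠ 0)]
  rw [e1, e2, ← integral_dyadic_add (memLp_stepFun _ _ _).intervalIntegrable hle' hle,
    ← integral_dyadic_add hf.intervalIntegrable hle' hle]
  refine Finset.sum_congr rfl fun k hk => ?_
  rw [integral_dyadicStep _ ((Finset.mem_Ico.1 hk).2.trans_le hle), dyadicAvg]
  field_simp

/-! ### Integrals of step functions under the Wiener measure -/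

lemma coord_zero (w : wienerSpace) : coord 0 w = 0 := w.2

lemma path_eq_coord (w : wienerSpace) (s : ℝ) :
    path w s = coord (Set.projIcc 0 1 zero_le_one s) w := rfl

lemma continuous_coord (t : unitInterval) : Continuous (coord t) :=
  (continuous_eval_const t).comp continuous_subtype_val

lemma continuous_path_eval (s : ℝ) : Continuous fun w : wienerSpace => path w s :=
  continuous_coord _

lemma continuous_stepIntegral (N : ℕ) (c t : ℕ → ℝ) : Continuous (stepIntegral N c t) := by
  unfold stepIntegral
  exact continuous_finsetSum _ fun i _ =>
    continuous_const.mul ((continuous_path_eval _).sub (continuous_path_eval _))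

variable {γ : Measure wienerSpace}

namespace IsWienerMeasure

lemma hasLaw_coord (hγ : IsWienerMeasure γ) (t : unitInterval) :
    HasLaw (coord t) (gaussianReal 0 (Real.toNNReal t)) γ := by
  have h := hγ.law_increment 0 t t.2.1
  simpa [coord_zero] using! h

lemma isGaussianProcess_coord (hγ : IsWienerMeasure γ) : IsGaussianProcess coord γ :=
  hγ.indepIncrements.isGaussianProcess (fun t => (hγ.hasLaw_coord t).hasGaussianLaw)
    (ae_of_all _ fun w => coord_zero w)

/-- Indexing by all data `(N, c, t)` at once makes step integrals on different partitions jointly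
Gaussian; later uses only reindex. -/
lemma isGaussianProcess_stepIntegral (hγ : IsWienerMeasure γ) :
    IsGaussianProcess (fun p : ℕ × (ℕ → ℝ) × (ℕ → ℝ) => stepIntegral p.1 p.2.1 p.2.2) γ := by
  classical
  refine hγ.isGaussianProcess_coord.of_isGaussianProcess fun p => ?_
  obtain ⟨N, c, t⟩ := p
  let τ : ℕ → unitInterval := fun i => Set.projIcc 0 1 zero_le_one (t i)
  have hmem : ∀ i : Fin (N + 1), τ i ∈ (Finset.range (N + 1)).image τ := fun i =>
    Finset.mem_image_of_mem _ (Finset.mem_range.2 i.2)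
  refine ⟨(Finset.range (N + 1)).image τ,
    ∑ i : Fin N, c i • (ContinuousLinearMap.proj ⟨τ (i + 1), hmem i.succ⟩
      - ContinuousLinearMap.proj ⟨τ i, hmem i.castSucc⟩), fun w => ?_⟩
  simp [stepIntegral, Finset.sum_range, path_eq_coord, τ]

lemma memLp_coord (hγ : IsWienerMeasure γ) (t : unitInterval) : MemLp (coord t) 2 γ :=
  (hγ.hasLaw_coord t).hasGaussianLaw.memLp_two

lemma memLp_path (hγ : IsWienerMeasure γ) (s : ℝ) :
    MemLp (fun w : wienerSpace => path w s) 2 γ :=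
  hγ.memLp_coord _

lemma memLp_const_mul_increment (hγ : IsWienerMeasure γ) (a r s : ℝ) :
    MemLp (fun w : wienerSpace => a * (path w r - path w s)) 2 γ :=
  ((hγ.memLp_path r).sub (hγ.memLp_path s)).const_mul a

lemma hasGaussianLaw_stepIntegral (hγ : IsWienerMeasure γ) (N : ℕ) (c t : ℕ → ℝ) :
    HasGaussianLaw (stepIntegral N c t) γ :=
  hγ.isGaussianProcess_stepIntegral.hasGaussianLaw_eval (N, c, t)

lemma memLp_stepIntegral (hγ : IsWienerMeasure γ) (N : ℕ) (c t : ℕ → ℝ) :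
    MemLp (stepIntegral N c t) 2 γ :=
  (hγ.hasGaussianLaw_stepIntegral N c t).memLp_two

lemma integral_coord (hγ : IsWienerMeasure γ) (t : unitInterval) : ∫ w, coord t w ∂γ = 0 := by
  rw [(hγ.hasLaw_coord t).integral_eq, integral_id_gaussianReal]

lemma integral_stepIntegral (hγ : IsWienerMeasure γ) (N : ℕ) (c t : ℕ → ℝ) :
    ∫ w, stepIntegral N c t w ∂γ = 0 := by
  have := hγ.isProbabilityMeasure
  have hi : ∀ s, Integrable (fun w => coord s w) γ := fun s =>
    (hγ.memLp_coord s).integrable one_le_two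
  simp only [stepIntegral, path_eq_coord]
  have hsub : ∀ r s a, Integrable (fun w => a * (coord r w - coord s w)) γ := fun r s a =>
    ((hi r).sub (hi s)).const_mul a
  rw [integral_finsetSum _ fun i _ => hsub _ _ _]
  refine Finset.sum_eq_zero fun i _ => ?_
  rw [integral_const_mul, integral_sub (hi _) (hi _), hγ.integral_coord, hγ.integral_coord]
  simp

/-- Polarization: the variances of `coord s`, `coord t` and their difference are all known. -/
lemma covariance_coord (hγ : IsWienerMeasure γ) (s t : unitInterval) :
    cov[coord s, coord t; γ] = min (s : ℝ) t := by
  have := hγ.isProbabilityMeasure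
  wlog hst : s ≤ t generalizing s t
  · rw [covariance_comm, this t s (le_of_not_ge hst), min_comm]
  have h := variance_sub (hγ.memLp_coord t) (hγ.memLp_coord s)
  have v : ∀ t : unitInterval, Var[coord t; γ] = t := fun t => by
    rw [(hγ.hasLaw_coord t).variance_eq, variance_id_gaussianReal, Real.coe_toNNReal _ t.2.1]
  have hst' : (s : ℝ) ≤ t := hst
  have v2 : Var[coord t - coord s; γ] = t - s := by
    rw [← Real.coe_toNNReal ((t : ℝ) - s) (by linarith),
      ← variance_id_gaussianReal (μ := 0), ← (hγ.law_increment s t hst).variance_eq]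
    rfl
  rw [v, v, v2] at h
  rw [min_eq_left hst', covariance_comm]
  linarith

lemma covariance_path (hγ : IsWienerMeasure γ) {s t : ℝ} (hs : s ∈ Set.Icc (0 : ℝ) 1)
    (ht : t ∈ Set.Icc (0 : ℝ) 1) :
    cov[fun w : wienerSpace => path w s, fun w : wienerSpace => path w t; γ] = min s t := by
  have := hγ.covariance_coord ⟨s, hs⟩ ⟨t, ht⟩
  simp only [path_eq_coord, Set.projIcc_of_mem zero_le_one hs, Set.projIcc_of_mem zero_le_one ht]
  exact this

end IsWienerMeasure

lemma integral_indicator_Ioc {a b s : ℝ} (c : ℝ) (ha : 0 ≤ a) (hab : a ≤ b) (hs : 0 ≤ s) :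
    ∫ x in (0 : ℝ)..s, (Set.Ioc a b).indicator (fun _ => c) x = c * (min b s - min a s) := by
  rw [intervalIntegral.integral_of_le hs, setIntegral_indicator measurableSet_Ioc,
    Set.Ioc_inter_Ioc, setIntegral_const, smul_eq_mul, mul_comm, Real.volume_real_Ioc,
    max_eq_right ha]
  congr 1
  rcases le_total s a with h | h
  · simp [h, h.trans hab]
  · rw [max_eq_left (by simp [h, hab]), min_eq_left h, min_comm]

namespace IsWienerMeasure

variable {N M : ℕ} {c d t u : ℕ → ℝ}

/-- The covariance with the path at `s` is the primitive of the step function at `s`. In this form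
the isometry for two different partitions follows by taking differences, with no common refinement.
-/
lemma covariance_stepIntegral_path (hγ : IsWienerMeasure γ)
    (ht : ∀ i ≤ N, t i ∈ Set.Icc (0 : ℝ) 1) (ht' : ∀ i < N, t i ≤ t (i + 1)) {s : ℝ}
    (hs : s ∈ Set.Icc (0 : ℝ) 1) :
    cov[stepIntegral N c t, fun w : wienerSpace => path w s; γ]
      = ∫ x in (0 : ℝ)..s, stepFun N c t x := by
  have := hγ.isProbabilityMeasure
  have hm := hγ.memLp_path
  have hi : ∀ i ∈ Finset.range N, IntervalIntegrable
      (fun x => (Set.Ioc (t i) (t (i + 1))).indicator (fun _ => c i) x) volume 0 s := fun i _ =>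
    IntervalIntegrable.mono_Icc (MemL2.intervalIntegrable
      (memLp_indicator_const 2 measurableSet_Ioc _ (Or.inr (measure_ne_top _ _))))
      ⟨le_rfl, zero_le_one⟩ hs
  simp only [stepFun]
  rw [intervalIntegral.integral_finsetSum hi]
  unfold stepIntegral
  rw [covariance_fun_sum_left' (fun i _ => hγ.memLp_const_mul_increment _ _ _) (hm _)]
  refine Finset.sum_congr rfl fun i hi => ?_
  have hi' := Finset.mem_range.1 hi
  rw [covariance_const_mul_left, covariance_fun_sub_left (hm _) (hm _) (hm _),
    hγ.covariance_path (ht _ hi') hs, hγ.covariance_path (ht _ hi'.le) hs,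
    integral_indicator_Ioc _ (ht _ hi'.le).1 (ht' _ hi') hs.1]

lemma covariance_stepIntegral (hγ : IsWienerMeasure γ)
    (ht : ∀ i ≤ N, t i ∈ Set.Icc (0 : ℝ) 1) (ht' : ∀ i < N, t i ≤ t (i + 1))
    (hu : ∀ i ≤ M, u i ∈ Set.Icc (0 : ℝ) 1) :
    cov[stepIntegral N c t, stepIntegral M d u; γ]
      = ∑ j ∈ Finset.range M, d j * ∫ x in u j..u (j + 1), stepFun N c t x := by
  have := hγ.isProbabilityMeasure
  have hm := hγ.memLp_path
  have hI := hγ.memLp_stepIntegral N c t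
  have h0 : (0 : ℝ) ∈ Set.Icc (0 : ℝ) 1 := ⟨le_rfl, zero_le_one⟩
  have hi := MemL2.intervalIntegrable (memLp_stepFun N c t)
  have : stepIntegral M d u = fun w => ∑ j ∈ Finset.range M,
    d j * (path w (u (j + 1)) - path w (u j)) := rfl
  rw [this, covariance_fun_sum_right' (fun i _ => hγ.memLp_const_mul_increment _ _ _) hI]
  refine Finset.sum_congr rfl fun j hj => ?_
  have hj' := Finset.mem_range.1 hj
  rw [covariance_const_mul_right, covariance_fun_sub_right hI (hm _) (hm _),
    hγ.covariance_stepIntegral_path ht ht' (hu _ hj'),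
    hγ.covariance_stepIntegral_path ht ht' (hu _ hj'.le),
    intervalIntegral.integral_interval_sub_left (IntervalIntegrable.mono_Icc hi h0 (hu _ hj'))
      (IntervalIntegrable.mono_Icc hi h0 (hu _ hj'.le))]

end IsWienerMeasure

/-! ### The martingale of dyadic integrals -/

lemma dyadicIntegral_eq (f : ℝ → ℝ) (n : ℕ) : dyadicIntegral f n
    = stepIntegral (2 ^ n) (dyadicAvg f n) fun k => (k : ℝ) / 2 ^ n := by
  ext w
  rw [dyadicIntegral]
  rfl

lemma continuous_dyadicIntegral (f : ℝ → ℝ) (n : ℕ) : Continuous (dyadicIntegral f n) := by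
  rw [dyadicIntegral_eq]
  exact continuous_stepIntegral _ _ _

namespace IsWienerMeasure

lemma hasGaussianLaw_dyadicIntegral (hγ : IsWienerMeasure γ) (f : ℝ → ℝ) (n : ℕ) :
    HasGaussianLaw (dyadicIntegral f n) γ := by
  rw [dyadicIntegral_eq]
  exact hγ.hasGaussianLaw_stepIntegral _ _ _

lemma memLp_dyadicIntegral (hγ : IsWienerMeasure γ) (f : ℝ → ℝ) (n : ℕ) :
    MemLp (dyadicIntegral f n) 2 γ :=
  (hγ.hasGaussianLaw_dyadicIntegral f n).memLp_two

lemma integral_dyadicIntegral (hγ : IsWienerMeasure γ) (f : ℝ → ℝ) (n : ℕ) :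
    ∫ w, dyadicIntegral f n w ∂γ = 0 := by
  rw [dyadicIntegral_eq]
  exact hγ.integral_stepIntegral _ _ _

/-- By the tower property the covariance sees only the coarser level, so increments are orthogonal
to earlier integrals. -/
lemma covariance_dyadicIntegral (hγ : IsWienerMeasure γ) {f : ℝ → ℝ} (hf : MemL2 f) {m n : ℕ}
    (hmn : m ≤ n) :
    cov[dyadicIntegral f n, dyadicIntegral f m; γ] = dyadicInner f f m := by
  have := hγ.covariance_stepIntegral (c := dyadicAvg f n) (d := dyadicAvg f m)
    (N := 2 ^ n) (M := 2 ^ m) (t := fun k : ℕ => (k : ℝ) / 2 ^ n)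
    (u := fun k : ℕ => (k : ℝ) / 2 ^ m)
    (fun i hi => dyadic_mem_Icc hi) (fun i _ => monotone_dyadic n (Nat.le_succ i))
    (fun i hi => dyadic_mem_Icc hi)
  rw [dyadicIntegral_eq, dyadicIntegral_eq, this, dyadicInner]
  refine Finset.sum_congr rfl fun j hj => ?_
  push_cast
  rw [integral_dyadicStep_avg hf hmn (Finset.mem_range.1 hj), mul_div_assoc]

/-- An increment of the dyadic integrals is independent of the previous ones. -/
lemma indepFun_dyadicIntegral_sub (hγ : IsWienerMeasure γ) {f : ℝ → ℝ} (hf : MemL2 f) (n : ℕ) :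
    IndepFun (fun w => dyadicIntegral f (n + 1) w - dyadicIntegral f n w)
      (fun w (j : Set.Iic n) => dyadicIntegral f j w) γ := by
  classical
  have := hγ.isProbabilityMeasure
  let X : Unit → wienerSpace → ℝ := fun _ w =>
    dyadicIntegral f (n + 1) w - dyadicIntegral f n w
  let Y : Set.Iic n → wienerSpace → ℝ := fun j => dyadicIntegral f j
  let G : ℕ → wienerSpace → ℝ := dyadicIntegral f
  have hG : IsGaussianProcess G γ := by
    rw [show G = fun n => _ from funext fun n => dyadicIntegral_eq f n]
    exact hγ.isGaussianProcess_stepIntegral.comp_right fun n =>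
      (2 ^ n, dyadicAvg f n, fun k : ℕ => (k : ℝ) / 2 ^ n)
  have hXY : IsGaussianProcess (Sum.elim X Y) γ := by
    refine hG.of_isGaussianProcess fun s => ?_
    rcases s with s | j
    · exact ⟨{n, n + 1}, ContinuousLinearMap.proj ⟨n + 1, by simp⟩
        - ContinuousLinearMap.proj ⟨n, by simp⟩, fun w => by simp [X, G]⟩
    · exact ⟨{j.1}, ContinuousLinearMap.proj ⟨j.1, by simp⟩, fun w => by simp [Y, G]⟩
  -- For a jointly Gaussian family, vanishing covariances give independence.
  have hind := hXY.indepFun_of_covariance_eq_zero (fun s => ?_) (fun j => ?_) fun s j => ?_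
  · exact hind.comp (measurable_pi_apply ()) measurable_id
  · exact ((continuous_dyadicIntegral f _).sub (continuous_dyadicIntegral f _)).aemeasurable
  · exact (continuous_dyadicIntegral f _).aemeasurable
  · have hm := hγ.memLp_dyadicIntegral f
    rw [covariance_fun_sub_left (hm _) (hm _) (hm _),
      hγ.covariance_dyadicIntegral hf (j.2.trans (Nat.le_succ n)),
      hγ.covariance_dyadicIntegral hf j.2, sub_self]

lemma martingale_dyadicIntegral (hγ : IsWienerMeasure γ) {f : ℝ → ℝ} (hf : MemL2 f) :
    Martingale (dyadicIntegral f) (Filtration.natural (dyadicIntegral f)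
      fun n => (continuous_dyadicIntegral f n).stronglyMeasurable) γ := by
  have := hγ.isProbabilityMeasure
  have hi : ∀ n, Integrable (dyadicIntegral f n) γ := fun n =>
    (hγ.memLp_dyadicIntegral f n).integrable one_le_two
  set ℱ := Filtration.natural (dyadicIntegral f)
      fun n => (continuous_dyadicIntegral f n).stronglyMeasurable with hℱ
  have hadp : StronglyAdapted ℱ (dyadicIntegral f) := Filtration.stronglyAdapted_natural _
  refine martingale_nat hadp hi fun n => ?_
  set D := fun w => dyadicIntegral f (n + 1) w - dyadicIntegral f n w with hD
  have hDc : Continuous D :=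
    (continuous_dyadicIntegral f _).sub (continuous_dyadicIntegral f _)
  have hDm : StronglyMeasurable[MeasurableSpace.comap D inferInstance] D :=
    (comap_measurable D).stronglyMeasurable
  -- The natural filtration at `n` is generated by the integrals of level at most `n`, so it lies
  -- below the σ-algebra of the vector of those integrals.
  have hind : Indep (MeasurableSpace.comap D inferInstance) (ℱ n) γ := by
    refine indep_of_indep_of_le_right (hγ.indepFun_dyadicIntegral_sub hf n) ?_
    refine iSup₂_le fun j hj => ?_
    rw [← measurable_iff_comap_le]
    have := (measurable_pi_apply (⟨j, hj⟩ : Set.Iic n)).comp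
      (comap_measurable fun w (j : Set.Iic n) => dyadicIntegral f j w)
    exact this
  have h1 := condExp_indep_eq hDc.measurable.comap_le (ℱ.le n) hDm hind
  have h2 := condExp_add (m := ℱ n) (hi n) (((hi (n + 1)).sub (hi n)))
  have h3 : dyadicIntegral f n + (dyadicIntegral f (n + 1) - dyadicIntegral f n)
      = dyadicIntegral f (n + 1) := add_sub_cancel _ _
  rw [h3, condExp_of_stronglyMeasurable (ℱ.le n) (hadp n) (hi n)] at h2
  have h4 : ∫ w, D w ∂γ = 0 := by
    rw [hD, integral_sub (hi _) (hi _), hγ.integral_dyadicIntegral, hγ.integral_dyadicIntegral,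
      sub_zero]
  filter_upwards [h1, h2] with w hw1 hw2
  rw [hw2, Pi.add_apply]
  change _ = _ + (γ[D | ℱ n]) w
  rw [hw1, h4, add_zero]

lemma variance_dyadicIntegral (hγ : IsWienerMeasure γ) {f : ℝ → ℝ} (hf : MemL2 f) (n : ℕ) :
    Var[dyadicIntegral f n; γ] = dyadicInner f f n := by
  rw [← covariance_self (continuous_dyadicIntegral f n).aemeasurable,
    hγ.covariance_dyadicIntegral hf le_rfl]

lemma ae_exists_tendsto_dyadicIntegral (hγ : IsWienerMeasure γ) {f : ℝ → ℝ} (hf : MemL2 f) :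
    ∀ᵐ w ∂γ, ∃ c, Tendsto (fun n => dyadicIntegral f n w) atTop (𝓝 c) := by
  have := hγ.isProbabilityMeasure
  refine (hγ.martingale_dyadicIntegral hf).submartingale.exists_ae_tendsto_of_bdd
    (R := Real.toNNReal (√(∫ s in (0 : ℝ)..1, f s ^ 2))) fun n => ?_
  refine (eLpNorm_le_eLpNorm_of_exponent_le one_le_two
    (continuous_dyadicIntegral f n).aestronglyMeasurable).trans ?_
  rw [eLpNorm_two_eq (hγ.memLp_dyadicIntegral f n)]
  refine ENNReal.ofReal_le_ofReal (Real.sqrt_le_sqrt ?_)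
  rw [← variance_of_integral_eq_zero (continuous_dyadicIntegral f n).aemeasurable
    (hγ.integral_dyadicIntegral f n), hγ.variance_dyadicIntegral hf]
  exact dyadicInner_self_le hf n

end IsWienerMeasure

/-! ### The law of the Wiener integral -/

lemma tendsto_wienerIntegral {f : ℝ → ℝ} {w : wienerSpace}
    (h : ∃ c, Tendsto (fun n => dyadicIntegral f n w) atTop (𝓝 c)) :
    Tendsto (fun n => dyadicIntegral f n w) atTop (𝓝 (wienerIntegral f w)) := by
  rw [wienerIntegral, dif_pos h]
  exact h.choose_spec

lemma wienerIntegral_eq_of_tendsto {f : ℝ → ℝ} {w : wienerSpace} {c : ℝ}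
    (h : Tendsto (fun n => dyadicIntegral f n w) atTop (𝓝 c)) : wienerIntegral f w = c :=
  tendsto_nhds_unique (tendsto_wienerIntegral ⟨c, h⟩) h

lemma wienerIntegral_of_not_exists {f : ℝ → ℝ} {w : wienerSpace}
    (h : ¬ ∃ c, Tendsto (fun n => dyadicIntegral f n w) atTop (𝓝 c)) :
    wienerIntegral f w = 0 := by
  rw [wienerIntegral, dif_neg h]

/-- An almost sure limit of centred Gaussian variables is Gaussian if the variances converge. -/
lemma hasLaw_gaussianReal_of_tendsto {Ω : Type*} {m : MeasurableSpace Ω} {μ : Measure Ω}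
    [IsProbabilityMeasure μ] {X : ℕ → Ω → ℝ} {Y : Ω → ℝ} {v : ℕ → ℝ} {v' : ℝ}
    (hX : ∀ n, HasLaw (X n) (gaussianReal 0 (Real.toNNReal (v n))) μ)
    (hv : Tendsto v atTop (𝓝 v'))
    (h : ∀ᵐ ω ∂μ, Tendsto (fun n => X n ω) atTop (𝓝 (Y ω))) :
    HasLaw Y (gaussianReal 0 (Real.toNNReal v')) μ := by
  have hY : AEMeasurable Y μ :=
    aemeasurable_of_tendsto_metrizable_ae atTop (fun n => (hX n).aemeasurable) h
  refine ⟨hY, ?_⟩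
  have hprob : IsProbabilityMeasure (μ.map Y) := Measure.isProbabilityMeasure_map hY
  refine Measure.ext_of_charFun (funext fun t => ?_)
  have hcf : ∀ Z : Ω → ℝ, AEMeasurable Z μ →
      charFun (μ.map Z) t = ∫ ω, Complex.exp (t * Z ω * Complex.I) ∂μ := fun Z hZ => by
    rw [charFun_apply_real, integral_map hZ (by fun_prop)]
  -- Dominated convergence with bound `1`; the same characteristic functions also converge to the
  -- Gaussian one, and limits are unique.
  have h1 : Tendsto (fun n => charFun (μ.map (X n)) t) atTop (𝓝 (charFun (μ.map Y) t)) := by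
    rw [hcf Y hY]
    simp only [fun n => hcf (X n) (hX n).aemeasurable]
    refine tendsto_integral_of_dominated_convergence (fun _ => 1) (fun n => ?_)
      (integrable_const _) (fun n => ae_of_all _ fun ω => ?_) ?_
    · have := (hX n).aemeasurable
      exact (by fun_prop : AEMeasurable _ μ).aestronglyMeasurable
    · rw [← Complex.ofReal_mul, Complex.norm_exp_ofReal_mul_I]
    · filter_upwards [h] with ω hω
      have hc : Continuous fun x : ℝ => Complex.exp (t * x * Complex.I) := by fun_prop
      exact (hc.tendsto _).comp hω
  refine tendsto_nhds_unique h1 ?_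
  simp only [fun n => (hX n).map_eq, charFun_gaussianReal]
  have hc : Continuous fun x : ℝ =>
      Complex.exp (t * (0 : ℝ) * Complex.I - (Real.toNNReal x : ℝ) * t ^ 2 / 2) := by
    have := continuous_real_toNNReal
    fun_prop
  exact (hc.tendsto v').comp hv

variable {f : ℝ → ℝ}

namespace IsWienerMeasure

lemma hasLaw_dyadicIntegral (hγ : IsWienerMeasure γ) (hf : MemL2 f) (n : ℕ) :
    HasLaw (dyadicIntegral f n) (gaussianReal 0 (Real.toNNReal (dyadicInner f f n))) γ := by
  refine ⟨(continuous_dyadicIntegral f n).aemeasurable, ?_⟩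
  rw [(hγ.hasGaussianLaw_dyadicIntegral f n).map_eq_gaussianReal, hγ.integral_dyadicIntegral,
    hγ.variance_dyadicIntegral hf]

lemma hasLaw_dyadicIntegral_sub (hγ : IsWienerMeasure γ) (hf : MemL2 f) {m n : ℕ} (hmn : m ≤ n) :
    HasLaw (dyadicIntegral f n - dyadicIntegral f m)
      (gaussianReal 0 (Real.toNNReal (dyadicInner f f n - dyadicInner f f m))) γ := by
  have := hγ.isProbabilityMeasure
  have hm := hγ.memLp_dyadicIntegral f
  have hg : HasGaussianLaw (dyadicIntegral f n - dyadicIntegral f m) γ := by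
    rw [dyadicIntegral_eq, dyadicIntegral_eq]
    exact hγ.isGaussianProcess_stepIntegral.hasGaussianLaw_sub
      (s := (2 ^ n, dyadicAvg f n, fun k : ℕ => (k : ℝ) / 2 ^ n))
      (t := (2 ^ m, dyadicAvg f m, fun k : ℕ => (k : ℝ) / 2 ^ m))
  refine ⟨hg.aemeasurable, ?_⟩
  rw [hg.map_eq_gaussianReal, variance_sub (hm n) (hm m), hγ.variance_dyadicIntegral hf,
    hγ.variance_dyadicIntegral hf, hγ.covariance_dyadicIntegral hf hmn,
    integral_sub' ((hm n).integrable one_le_two) ((hm m).integrable one_le_two),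
    hγ.integral_dyadicIntegral, hγ.integral_dyadicIntegral]
  congr 2 <;> ring

lemma ae_tendsto_wienerIntegral (hγ : IsWienerMeasure γ) (hf : MemL2 f) :
    ∀ᵐ w ∂γ, Tendsto (fun n => dyadicIntegral f n w) atTop (𝓝 (wienerIntegral f w)) := by
  filter_upwards [hγ.ae_exists_tendsto_dyadicIntegral hf] with w hw
  exact tendsto_wienerIntegral hw

lemma hasLaw_wienerIntegral (hγ : IsWienerMeasure γ) (hf : MemL2 f) :
    HasLaw (wienerIntegral f)
      (gaussianReal 0 (Real.toNNReal (∫ s in (0 : ℝ)..1, f s ^ 2))) γ :=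
  have := hγ.isProbabilityMeasure
  hasLaw_gaussianReal_of_tendsto (fun n => hγ.hasLaw_dyadicIntegral hf n)
    (tendsto_dyadicInner_self hf) (hγ.ae_tendsto_wienerIntegral hf)

/-- Gives the exact `L²` error of the dyadic integrals. The index is shifted by `m` because the law
of a difference is known only when the first level is the finer one. -/
lemma hasLaw_wienerIntegral_sub (hγ : IsWienerMeasure γ) (hf : MemL2 f) (m : ℕ) :
    HasLaw (wienerIntegral f - dyadicIntegral f m) (gaussianReal 0
      (Real.toNNReal ((∫ s in (0 : ℝ)..1, f s ^ 2) - dyadicInner f f m))) γ := by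
  have := hγ.isProbabilityMeasure
  refine hasLaw_gaussianReal_of_tendsto
    (X := fun n => dyadicIntegral f (n + m) - dyadicIntegral f m)
    (fun n => hγ.hasLaw_dyadicIntegral_sub hf (Nat.le_add_left m n))
    (((tendsto_add_atTop_iff_nat m).2 (tendsto_dyadicInner_self hf)).sub_const _) ?_
  filter_upwards [hγ.ae_tendsto_wienerIntegral hf] with w hw
  exact ((tendsto_add_atTop_iff_nat m).2 hw).sub_const _

lemma memLp_wienerIntegral (hγ : IsWienerMeasure γ) (hf : MemL2 f) (p : ℝ≥0∞) (hp : p ≠ ⊤) :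
    MemLp (wienerIntegral f) p γ :=
  (hγ.hasLaw_wienerIntegral hf).hasGaussianLaw.memLp hp

/-- The pathwise Wiener integral is a version of the Wiener integral. -/
theorem isWienerIntegral_wienerIntegral (hγ : IsWienerMeasure γ) (hf : MemL2 f) :
    IsWienerIntegral γ f (wienerIntegral f) := by
  refine ⟨hγ.memLp_wienerIntegral hf 2 (by simp), fun n => 2 ^ n, dyadicAvg f,
    fun n k => (k : ℝ) / 2 ^ n,
    fun n => ⟨fun i hi => dyadic_mem_Icc hi, fun i _ => monotone_dyadic n (Nat.le_succ i)⟩, ?_, ?_⟩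
  · refine (tendsto_eLpNorm_dyadicStep_sub hf).congr fun n => ?_
    exact eLpNorm_sub_comm _ _ _ _
  · have h1 : Tendsto (fun n => ENNReal.ofReal
        (√((∫ s in (0 : ℝ)..1, f s ^ 2) - dyadicInner f f n))) atTop (𝓝 0) := by
      have h := (tendsto_dyadicInner_self hf).const_sub (∫ s in (0 : ℝ)..1, f s ^ 2)
      rw [sub_self] at h
      have h2 := ENNReal.tendsto_ofReal h.sqrt
      rwa [Real.sqrt_zero, ENNReal.ofReal_zero] at h2
    refine h1.congr fun n => ?_
    have hl := hγ.hasLaw_wienerIntegral_sub hf n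
    have hmean : ∫ w, (wienerIntegral f - dyadicIntegral f n) w ∂γ = 0 := by
      rw [hl.integral_eq, integral_id_gaussianReal]
    have hvar := hl.variance_eq
    rw [variance_id_gaussianReal, variance_of_integral_eq_zero hl.aemeasurable hmean,
      Real.coe_toNNReal _ (sub_nonneg.2 (dyadicInner_self_le hf n))] at hvar
    rw [← hvar, ← eLpNorm_two_eq hl.hasGaussianLaw.memLp_two, eLpNorm_sub_comm, dyadicIntegral_eq]
    rfl

end IsWienerMeasure

/-! ### Linearity of the Wiener integral and its behaviour under Cameron-Martin shifts -/

lemma dyadicIntegral_add {f g : ℝ → ℝ} (hf : MemL2 f) (hg : MemL2 g) (n : ℕ) (w : wienerSpace) :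
    dyadicIntegral (fun s => f s + g s) n w = dyadicIntegral f n w + dyadicIntegral g n w := by
  simp only [dyadicIntegral_eq, stepIntegral]
  rw [← Finset.sum_add_distrib]
  refine Finset.sum_congr rfl fun k hk => ?_
  rw [dyadicAvg_add hf hg (Finset.mem_range.1 hk)]
  ring

lemma dyadicIntegral_const_mul (a : ℝ) (f : ℝ → ℝ) (n : ℕ) (w : wienerSpace) :
    dyadicIntegral (fun s => a * f s) n w = a * dyadicIntegral f n w := by
  simp only [dyadicIntegral_eq, stepIntegral, Finset.mul_sum]
  refine Finset.sum_congr rfl fun k _ => ?_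
  rw [dyadicAvg_const_mul]
  ring

lemma dyadicIntegral_sum {ι : Type*} (S : Finset ι) {f : ι → ℝ → ℝ} (hf : ∀ i, MemL2 (f i))
    (a : ι → ℝ) (n : ℕ) (w : wienerSpace) :
    dyadicIntegral (fun s => ∑ i ∈ S, a i * f i s) n w
      = ∑ i ∈ S, a i * dyadicIntegral (f i) n w := by
  classical
  induction S using Finset.induction_on with
  | empty =>
    simpa using dyadicIntegral_const_mul 0 (fun _ => 0) n w
  | insert j S hj ih =>
    simp only [Finset.sum_insert hj]
    rw [dyadicIntegral_add ((hf j).const_mul _)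
      (memLp_finsetSum S fun i _ => (hf i).const_mul (a i)), ih, dyadicIntegral_const_mul]

lemma IsWienerMeasure.wienerIntegral_sum (hγ : IsWienerMeasure γ) {ι : Type*} [Finite ι]
    (S : Finset ι) {f : ι → ℝ → ℝ} (hf : ∀ i, MemL2 (f i)) (a : ι → ℝ) :
    ∀ᵐ w ∂γ, wienerIntegral (fun s => ∑ i ∈ S, a i * f i s) w
      = ∑ i ∈ S, a i * wienerIntegral (f i) w := by
  filter_upwards [ae_all_iff.2 fun i => hγ.ae_tendsto_wienerIntegral (hf i)] with w hw
  refine wienerIntegral_eq_of_tendsto ?_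
  simp only [dyadicIntegral_sum S hf]
  exact tendsto_finsetSum _ fun i _ => (hw i).const_mul _

lemma IsWienerMeasure.wienerIntegral_add (hγ : IsWienerMeasure γ) {f g : ℝ → ℝ} (hf : MemL2 f)
    (hg : MemL2 g) :
    ∀ᵐ w ∂γ, wienerIntegral (fun s => f s + g s) w = wienerIntegral f w + wienerIntegral g w := by
  filter_upwards [hγ.ae_tendsto_wienerIntegral hf, hγ.ae_tendsto_wienerIntegral hg] with w h1 h2
  refine wienerIntegral_eq_of_tendsto ?_
  simp only [dyadicIntegral_add hf hg]
  exact h1.add h2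

lemma IsWienerMeasure.wienerIntegral_const_mul (hγ : IsWienerMeasure γ) {f : ℝ → ℝ}
    (hf : MemL2 f) (a : ℝ) :
    ∀ᵐ w ∂γ, wienerIntegral (fun s => a * f s) w = a * wienerIntegral f w := by
  filter_upwards [hγ.ae_tendsto_wienerIntegral hf] with w h1
  refine wienerIntegral_eq_of_tendsto ?_
  simp only [dyadicIntegral_const_mul]
  exact h1.const_mul a

lemma path_add_smul (w θ : wienerSpace) (ε s : ℝ) :
    path (w + ε • θ) s = path w s + ε * path θ s := rfl

lemma dyadicIntegral_add_smul (f : ℝ → ℝ) (n : ℕ) (w θ : wienerSpace) (ε : ℝ) :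
    dyadicIntegral f n (w + ε • θ) = dyadicIntegral f n w + ε * dyadicIntegral f n θ := by
  simp only [dyadicIntegral_eq, stepIntegral, path_add_smul, Finset.mul_sum]
  rw [← Finset.sum_add_distrib]
  refine Finset.sum_congr rfl fun k _ => ?_
  ring

/-- Absolute continuity makes each increment of `θ` the integral of its derivative, that is, a
dyadic average up to the cell length. -/
lemma dyadicIntegral_cameronMartin (f : ℝ → ℝ) {θ : wienerSpace} (hθ : θ ∈ cameronMartin)
    (n : ℕ) : dyadicIntegral f n θ = dyadicInner f (pathDeriv θ) n := by
  rw [dyadicIntegral_eq, stepIntegral, dyadicInner]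
  refine Finset.sum_congr rfl fun k hk => ?_
  have hk' := Finset.mem_range.1 hk
  have hac : AbsolutelyContinuousOnInterval (path θ) ((k : ℝ) / 2 ^ n)
      (((k + 1 : ℕ) : ℝ) / 2 ^ n) := by
    refine hθ.1.mono ?_
    rw [Set.uIcc_of_le zero_le_one]
    exact Set.uIcc_subset_Icc (dyadic_mem_Icc hk'.le) (dyadic_mem_Icc hk')
  rw [← hac.integral_deriv_eq_sub, dyadicAvg, dyadicAvg]
  simp only [pathDeriv]
  push_cast
  field_simp

lemma tendsto_dyadicIntegral_cameronMartin {f : ℝ → ℝ} (hf : MemL2 f) {θ : wienerSpace}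
    (hθ : θ ∈ cameronMartin) :
    Tendsto (fun n => dyadicIntegral f n θ) atTop
      (𝓝 (∫ s in (0 : ℝ)..1, f s * pathDeriv θ s)) := by
  simp only [dyadicIntegral_cameronMartin f hθ]
  exact tendsto_dyadicInner hf hθ.2

open Classical in
/-- The derivative of `[h]` at `w` in the direction `θ`. -/
def bracketDeriv (h θ w : wienerSpace) : ℝ :=
  if ∃ c, Tendsto (fun n => dyadicIntegral (pathDeriv h) n w) atTop (𝓝 c) then
    ∫ s in (0 : ℝ)..1, pathDeriv h s * pathDeriv θ s else 0

section Shift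

variable {h θ : wienerSpace}

lemma exists_tendsto_add_smul_iff (hh : h ∈ cameronMartin) (hθ : θ ∈ cameronMartin)
    (w : wienerSpace) (ε : ℝ) :
    (∃ c, Tendsto (fun n => dyadicIntegral (pathDeriv h) n (w + ε • θ)) atTop (𝓝 c)) ↔
      ∃ c, Tendsto (fun n => dyadicIntegral (pathDeriv h) n w) atTop (𝓝 c) := by
  have ht := (tendsto_dyadicIntegral_cameronMartin hh.2 hθ).const_mul ε
  constructor
  · rintro ⟨c, hc⟩
    refine ⟨_, (hc.sub ht).congr fun n => ?_⟩
    rw [dyadicIntegral_add_smul, add_sub_cancel_right]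
  · rintro ⟨c, hc⟩
    refine ⟨_, (hc.add ht).congr fun n => ?_⟩
    rw [dyadicIntegral_add_smul]

/-- Lets the slope be treated as a constant when differentiating repeatedly along `θ`. -/
lemma bracketDeriv_add_smul (hh : h ∈ cameronMartin) (hθ : θ ∈ cameronMartin) (w : wienerSpace)
    (ε : ℝ) : bracketDeriv h θ (w + ε • θ) = bracketDeriv h θ w := by
  classical
  rw [bracketDeriv, bracketDeriv]
  exact if_congr (exists_tendsto_add_smul_iff hh hθ w ε) rfl rfl

/-- Off the convergence set the whole line stays off it, and both brackets take the default value
`0`. Hence no exceptional set is needed for the derivatives. -/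
lemma bracket_add_smul (hh : h ∈ cameronMartin) (hθ : θ ∈ cameronMartin) (w : wienerSpace)
    (ε : ℝ) : bracket h (w + ε • θ) = bracket h w + ε * bracketDeriv h θ w := by
  by_cases hw : ∃ c, Tendsto (fun n => dyadicIntegral (pathDeriv h) n w) atTop (𝓝 c)
  · rw [bracketDeriv, if_pos hw]
    refine wienerIntegral_eq_of_tendsto ?_
    simp only [dyadicIntegral_add_smul]
    exact (tendsto_wienerIntegral hw).add
      ((tendsto_dyadicIntegral_cameronMartin hh.2 hθ).const_mul ε)
  · rw [bracketDeriv, if_neg hw, bracket, bracket, wienerIntegral_of_not_exists hw,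
      wienerIntegral_of_not_exists ((exists_tendsto_add_smul_iff hh hθ w ε).not.2 hw)]
    simp

lemma IsWienerMeasure.ae_bracketDeriv_eq (hγ : IsWienerMeasure γ) (hh : h ∈ cameronMartin)
    (θ : wienerSpace) :
    ∀ᵐ w ∂γ, bracketDeriv h θ w = ∫ s in (0 : ℝ)..1, pathDeriv h s * pathDeriv θ s := by
  filter_upwards [hγ.ae_exists_tendsto_dyadicIntegral hh.2] with w hw
  rw [bracketDeriv, if_pos hw]

end Shift

/-! ### The iterates of `D_θ^*` at `1` and their exponential series -/

open Polynomial in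
/-- The Hermite polynomials of variance `c`: `H₀ = 1` and `Hₙ₊₁ = X Hₙ - c Hₙ'`. -/
def hermiteVar (c : ℝ) : ℕ → ℝ[X]
  | 0 => 1
  | n + 1 => X * hermiteVar c n - C c * derivative (hermiteVar c n)

/-- Differentiating once more in `z` reproduces the Hermite recursion at the point `x - z c`. The
variable is complex so that the Taylor series of an entire function applies. -/
lemma iteratedDeriv_exp_hermiteVar (c x : ℝ) (n : ℕ) :
    iteratedDeriv n (fun z : ℂ => Complex.exp (z * x - z ^ 2 * c / 2))
      = fun z => Polynomial.aeval ((x : ℂ) - z * c) (hermiteVar c n)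
        * Complex.exp (z * x - z ^ 2 * c / 2) := by
  induction n with
  | zero => simp [hermiteVar]
  | succ n ih =>
    rw [iteratedDeriv_succ, ih]
    ext z
    have h1 : HasDerivAt (fun z : ℂ => (x : ℂ) - z * c) (-(c : ℂ)) z := by
      simpa using ((hasDerivAt_id z).mul_const (c : ℂ)).const_sub (x : ℂ)
    have h2 := (Polynomial.hasDerivAt_aeval (hermiteVar c n) ((x : ℂ) - z * c)).comp z h1
    have h3 : HasDerivAt (fun z : ℂ => z * x - z ^ 2 * c / 2) (x - z * c) z := by
      have h := ((hasDerivAt_id z).mul_const (x : ℂ)).sub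
        ((((hasDerivAt_id z).pow 2).mul_const (c : ℂ)).div_const 2)
      refine h.congr_deriv ?_
      simp
      ring
    refine (h2.mul h3.cexp).deriv.trans ?_
    simp only [hermiteVar, map_sub, map_mul, Polynomial.aeval_X, Polynomial.aeval_C,
      Complex.coe_algebraMap, Function.comp_apply]
    ring

lemma hasSum_hermiteVar (c x : ℝ) :
    HasSum (fun n : ℕ => ((n.factorial : ℝ))⁻¹ * (hermiteVar c n).eval x)
      (Real.exp (x - c / 2)) := by
  have hd : Differentiable ℂ fun z : ℂ => Complex.exp (z * x - z ^ 2 * c / 2) := by fun_prop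
  have h := Complex.hasSum_taylorSeries_of_entire hd 0 1
  rw [← Complex.hasSum_ofReal]
  convert! h using 1
  · ext n
    rw [iteratedDeriv_exp_hermiteVar]
    have : (Polynomial.aeval (x : ℂ)) (hermiteVar c n) = ((hermiteVar c n).eval x : ℝ) :=
      (Polynomial.aeval_algebraMap_apply_eq_algebraMap_eval x (hermiteVar c n))
    simp [this]
  · push_cast
    simp

variable {θ : wienerSpace}

lemma hasDerivAt_hermiteVar_shift (hθ : θ ∈ cameronMartin) (n : ℕ) (w : wienerSpace) :
    HasDerivAt (fun ε : ℝ => (hermiteVar (bracketDeriv θ θ (w + ε • θ)) n).eval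
      (bracket θ (w + ε • θ)))
      ((hermiteVar (bracketDeriv θ θ w) n).derivative.eval (bracket θ w) * bracketDeriv θ θ w)
      0 := by
  simp only [bracketDeriv_add_smul hθ hθ, bracket_add_smul hθ hθ]
  have h1 : HasDerivAt (fun ε : ℝ => bracket θ w + ε * bracketDeriv θ θ w)
      (bracketDeriv θ θ w) 0 := by
    simpa using ((hasDerivAt_id (0 : ℝ)).mul_const (bracketDeriv θ θ w)).const_add (bracket θ w)
  have h2 := ((hermiteVar (bracketDeriv θ θ w) n).hasDerivAt
    (bracket θ w + 0 * bracketDeriv θ θ w)).comp 0 h1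
  simpa using! h2

/-- The recursion `Hₙ₊₁ = X Hₙ - c Hₙ'` is the adjoint operator itself, with `c` the slope of
`bracket θ` along `θ`, so the identity holds at every path. -/
lemma iterate_dirDerivAdj_one (hθ : θ ∈ cameronMartin) (n : ℕ) :
    (dirDerivAdj θ)^[n] (fun _ => 1)
      = fun w => (hermiteVar (bracketDeriv θ θ w) n).eval (bracket θ w) := by
  induction n with
  | zero => simp [hermiteVar]
  | succ n ih =>
    rw [Function.iterate_succ_apply', ih]
    ext w
    rw [dirDerivAdj, dirDeriv, (hasDerivAt_hermiteVar_shift hθ n w).deriv]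
    simp only [hermiteVar, Polynomial.eval_sub, Polynomial.eval_mul, Polynomial.eval_X,
      Polynomial.eval_C]
    ring

lemma dirDerivExists_iterate_dirDerivAdj_one (hθ : θ ∈ cameronMartin) (n : ℕ)
    (w : wienerSpace) : DirDerivExists θ ((dirDerivAdj θ)^[n] fun _ => 1) w := by
  rw [iterate_dirDerivAdj_one hθ]
  exact (hasDerivAt_hermiteVar_shift hθ n w).differentiableAt

lemma hasSum_expTerm_dirDerivAdj_one (hθ : θ ∈ cameronMartin) (w : wienerSpace) :
    HasSum (expTerm (dirDerivAdj θ) (fun _ => 1) w)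
      (Real.exp (bracket θ w - bracketDeriv θ θ w / 2)) := by
  unfold expTerm
  simp only [iterate_dirDerivAdj_one hθ]
  exact hasSum_hermiteVar _ _

/-! ### The exponential series of `D_θ` on functionals polynomial along `θ` -/

lemma iterate_dirDeriv_of_polynomial {F : wienerSpace → ℝ} {q : wienerSpace → Polynomial ℝ}
    (hq : ∀ w (ε : ℝ), F (w + ε • θ) = (q w).eval ε) (n : ℕ) (w : wienerSpace) (ε : ℝ) :
    ((dirDeriv θ)^[n] F) (w + ε • θ) = (Polynomial.derivative^[n] (q w)).eval ε := by
  -- The derivative at `w + ε • θ` requires the previous iterate at nearby points of the line, so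
  -- `ε` must vary.
  induction n generalizing ε with
  | zero => exact hq w ε
  | succ n ih =>
    rw [Function.iterate_succ_apply', Function.iterate_succ_apply', dirDeriv]
    simp only [add_assoc, ← add_smul, ih]
    have h := ((Polynomial.derivative^[n] (q w)).hasDerivAt (ε + 0)).comp (0 : ℝ)
      ((hasDerivAt_id (0 : ℝ)).const_add ε)
    simpa using! h.deriv

lemma dirDerivExists_of_polynomial {F : wienerSpace → ℝ} {q : wienerSpace → Polynomial ℝ}
    (hq : ∀ w (ε : ℝ), F (w + ε • θ) = (q w).eval ε) (n : ℕ) (w : wienerSpace) :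
    DirDerivExists θ ((dirDeriv θ)^[n] F) w := by
  unfold DirDerivExists
  simp only [iterate_dirDeriv_of_polynomial hq]
  exact Polynomial.differentiableAt _

/-- The terms are the coefficients of `q w`, and their finite sum is its value at `ε = 1`. -/
lemma hasSum_expTerm_of_polynomial {F : wienerSpace → ℝ} {q : wienerSpace → Polynomial ℝ}
    (hq : ∀ w (ε : ℝ), F (w + ε • θ) = (q w).eval ε) (w : wienerSpace) :
    HasSum (expTerm (dirDeriv θ) F w) (F (w + θ)) := by
  have hterm : ∀ n, expTerm (dirDeriv θ) F w n = (q w).coeff n := fun n => by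
    have h := iterate_dirDeriv_of_polynomial hq n w 0
    rw [zero_smul, add_zero, ← Polynomial.coeff_zero_eq_eval_zero,
      Polynomial.coeff_iterate_derivative] at h
    rw [expTerm, h, zero_add, Nat.descFactorial_self, nsmul_eq_mul,
      inv_mul_cancel_left₀ (by exact_mod_cast n.factorial_ne_zero)]
  have h1 := hq w 1
  rw [one_smul, Polynomial.eval_eq_sum_range] at h1
  simp only [one_pow, mul_one] at h1
  rw [h1, funext hterm]
  refine hasSum_sum_of_ne_finset_zero fun n hn => ?_
  exact Polynomial.coeff_eq_zero_of_natDegree_lt (by simpa using hn)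

/-- The polynomial `ε ↦ p(x + ε a)`. -/
def linePoly {n : ℕ} (p : MvPolynomial (Fin n) ℝ) (x a : Fin n → ℝ) : Polynomial ℝ :=
  MvPolynomial.aeval (fun i => Polynomial.C (x i) + Polynomial.X * Polynomial.C (a i)) p

lemma eval_linePoly {n : ℕ} (p : MvPolynomial (Fin n) ℝ) (x a : Fin n → ℝ) (ε : ℝ) :
    (linePoly p x a).eval ε = MvPolynomial.eval (fun i => x i + ε * a i) p := by
  have : (Polynomial.aeval ε) (linePoly p x a)
      = MvPolynomial.aeval (fun i => x i + ε * a i) p := by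
    rw [linePoly, ← AlgHom.comp_apply, MvPolynomial.comp_aeval]
    simp [mul_comm _ ε]
  rw [Polynomial.coe_aeval_eq_eval, MvPolynomial.aeval_eq_eval] at this
  exact this

/-! ### The Cameron-Martin formula for Wiener integrals -/

variable {g : ℝ → ℝ}

/-- The exponential martingale `exp(∫ g dw - ½ ∫ g²)`. -/
def expMartingale (g : ℝ → ℝ) (w : wienerSpace) : ℝ :=
  Real.exp (wienerIntegral g w - 1 / 2 * ∫ s in (0 : ℝ)..1, g s ^ 2)

lemma expMartingale_pos (g : ℝ → ℝ) (w : wienerSpace) : 0 < expMartingale g w :=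
  Real.exp_pos _

/-- The measure with density `exp(∫ g dw - ½ ∫ g²)` with respect to `γ`. -/
def shiftedMeasure (γ : Measure wienerSpace) (g : ℝ → ℝ) : Measure wienerSpace :=
  γ.withDensity fun w => ENNReal.ofReal (expMartingale g w)

namespace IsWienerMeasure

lemma aemeasurable_wienerIntegral (hγ : IsWienerMeasure γ) (hf : MemL2 f) :
    AEMeasurable (wienerIntegral f) γ :=
  (hγ.hasLaw_wienerIntegral hf).aemeasurable

lemma aemeasurable_expMartingale (hγ : IsWienerMeasure γ) (hg : MemL2 g) :
    AEMeasurable (expMartingale g) γ :=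
  Real.measurable_exp.comp_aemeasurable ((hγ.aemeasurable_wienerIntegral hg).sub_const _)

lemma mgf_wienerIntegral (hγ : IsWienerMeasure γ) (hf : MemL2 f) (t : ℝ) :
    mgf (wienerIntegral f) γ t = Real.exp ((∫ s in (0 : ℝ)..1, f s ^ 2) * t ^ 2 / 2) := by
  rw [mgf_gaussianReal (hγ.hasLaw_wienerIntegral hf).map_eq, Real.coe_toNNReal _
    (intervalIntegral.integral_nonneg zero_le_one fun s _ => sq_nonneg _)]
  simp

lemma integrable_exp_mul_wienerIntegral (hγ : IsWienerMeasure γ) (hf : MemL2 f) (t : ℝ) :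
    Integrable (fun w => Real.exp (t * wienerIntegral f w)) γ := by
  have hl := hγ.hasLaw_wienerIntegral hf
  have h := integrable_exp_mul_gaussianReal (μ := 0)
    (v := Real.toNNReal (∫ s in (0 : ℝ)..1, f s ^ 2)) t
  rw [← hl.map_eq] at h
  exact h.comp_aemeasurable hl.aemeasurable

lemma integrable_expMartingale (hγ : IsWienerMeasure γ) (hg : MemL2 g) :
    Integrable (expMartingale g) γ := by
  have h := (hγ.integrable_exp_mul_wienerIntegral hg 1).mul_const
    (Real.exp (-(1 / 2 * ∫ s in (0 : ℝ)..1, g s ^ 2)))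
  simp only [← Real.exp_add, one_mul, ← sub_eq_add_neg] at h
  exact h

lemma isFiniteMeasure_shiftedMeasure (hγ : IsWienerMeasure γ) (hg : MemL2 g) :
    IsFiniteMeasure (shiftedMeasure γ g) :=
  isFiniteMeasure_withDensity_ofReal (hγ.integrable_expMartingale hg).2

lemma integral_shiftedMeasure (hγ : IsWienerMeasure γ) (hg : MemL2 g) (u : wienerSpace → ℝ) :
    ∫ w, u w ∂(shiftedMeasure γ g) = ∫ w, u w * expMartingale g w ∂γ := by
  rw [shiftedMeasure, integral_withDensity_eq_integral_toReal_smul₀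
    (hγ.aemeasurable_expMartingale hg).ennreal_ofReal (by simp)]
  refine integral_congr_ae (ae_of_all _ fun w => ?_)
  simp only
  rw [ENNReal.toReal_ofReal (expMartingale_pos g w).le, smul_eq_mul, mul_comm]

lemma integrable_shiftedMeasure_iff (hγ : IsWienerMeasure γ) (hg : MemL2 g)
    (u : wienerSpace → ℝ) :
    Integrable u (shiftedMeasure γ g) ↔ Integrable (fun w => u w * expMartingale g w) γ := by
  rw [shiftedMeasure, integrable_withDensity_iff_integrable_smul₀'
    (hγ.aemeasurable_expMartingale hg).ennreal_ofReal (by simp)]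
  refine integrable_congr (ae_of_all _ fun w => ?_)
  simp only
  rw [ENNReal.toReal_ofReal (expMartingale_pos g w).le, smul_eq_mul, mul_comm]

/-- Completing the square: the exponential of `t` times the integral of `f`, times the density, is
almost surely the exponential of the integral of `t f + g`, up to a constant. The cross term `t ∫ f
g` of its variance is the shift. -/
lemma mgf_shiftedMeasure (hγ : IsWienerMeasure γ) (hf : MemL2 f) (hg : MemL2 g) :
    mgf (fun w => wienerIntegral f w + ∫ s in (0 : ℝ)..1, f s * g s) γ
      = mgf (wienerIntegral f) (shiftedMeasure γ g) := by
  ext t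
  have htf : MemL2 fun s => t * f s := hf.const_mul t
  have hsum : MemL2 fun s => t * f s + g s := htf.add hg
  have h1 : mgf (wienerIntegral f) (shiftedMeasure γ g) t
      = mgf (wienerIntegral fun s => t * f s + g s) γ 1
        * Real.exp (-(1 / 2 * ∫ s in (0 : ℝ)..1, g s ^ 2)) := by
    rw [mgf, hγ.integral_shiftedMeasure hg, mgf, ← integral_mul_const]
    refine integral_congr_ae ?_
    filter_upwards [hγ.wienerIntegral_add htf hg, hγ.wienerIntegral_const_mul hf t] with w h1 h2
    rw [h1, h2, expMartingale, ← Real.exp_add, ← Real.exp_add]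
    ring_nf
  have h2 : ∫ s in (0 : ℝ)..1, (t * f s + g s) ^ 2 = t ^ 2 * (∫ s in (0 : ℝ)..1, f s ^ 2)
      + 2 * t * (∫ s in (0 : ℝ)..1, f s * g s) + ∫ s in (0 : ℝ)..1, g s ^ 2 := by
    have i1 := hf.intervalIntegrable_sq.const_mul (t ^ 2)
    have i2 := (hf.intervalIntegrable_mul hg).const_mul (2 * t)
    rw [← intervalIntegral.integral_const_mul, ← intervalIntegral.integral_const_mul,
      ← intervalIntegral.integral_add i1 i2,
      ← intervalIntegral.integral_add (i1.add i2) hg.intervalIntegrable_sq]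
    congr 1
    ext s
    ring
  rw [h1, mgf_add_const, hγ.mgf_wienerIntegral hf, hγ.mgf_wienerIntegral hsum, h2,
    ← Real.exp_add, ← Real.exp_add]
  ring_nf

/-- The real exponential moments are all finite, so the strip on which the moment generating
function determines its analytic extension is the whole plane; the value used is at `Complex.I`. -/
lemma complexMGF_shiftedMeasure (hγ : IsWienerMeasure γ) (hf : MemL2 f) (hg : MemL2 g) (z : ℂ) :
    complexMGF (fun w => wienerIntegral f w + ∫ s in (0 : ℝ)..1, f s * g s) γ z
      = complexMGF (wienerIntegral f) (shiftedMeasure γ g) z := by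
  have := hγ.isProbabilityMeasure
  refine eqOn_complexMGF_of_mgf (hγ.mgf_shiftedMeasure hf hg) ?_
  have : integrableExpSet (fun w => wienerIntegral f w + ∫ s in (0 : ℝ)..1, f s * g s) γ
      = Set.univ := by
    refine Set.eq_univ_of_forall fun t => ?_
    have h := (hγ.integrable_exp_mul_wienerIntegral hf t).mul_const
      (Real.exp (t * ∫ s in (0 : ℝ)..1, f s * g s))
    simp only [← Real.exp_add, ← mul_add] at h
    exact h
  simp [this]

variable {n : ℕ} {F : Fin n → ℝ → ℝ}

lemma aemeasurable_wienerIntegral_pi (hγ : IsWienerMeasure γ) (hF : ∀ i, MemL2 (F i)) :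
    AEMeasurable (fun w i => wienerIntegral (F i) w) γ :=
  aemeasurable_pi_lambda _ fun i => hγ.aemeasurable_wienerIntegral (hF i)

lemma aemeasurable_wienerIntegral_pi_shiftedMeasure (hγ : IsWienerMeasure γ)
    (hF : ∀ i, MemL2 (F i)) (g : ℝ → ℝ) :
    AEMeasurable (fun w i => wienerIntegral (F i) w) (shiftedMeasure γ g) :=
  (hγ.aemeasurable_wienerIntegral_pi hF).mono_ac (withDensity_absolutelyContinuous _ _)

/-- **Cameron-Martin formula** for finitely many Wiener integrals. -/
theorem map_shiftedMeasure (hγ : IsWienerMeasure γ) (hF : ∀ i, MemL2 (F i)) (hg : MemL2 g) :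
    (shiftedMeasure γ g).map (fun w i => wienerIntegral (F i) w)
      = γ.map fun w i => wienerIntegral (F i) w + ∫ s in (0 : ℝ)..1, F i s * g s := by
  have := hγ.isProbabilityMeasure
  have := hγ.isFiniteMeasure_shiftedMeasure hg
  have hX := hγ.aemeasurable_wienerIntegral_pi hF
  have hXν := hγ.aemeasurable_wienerIntegral_pi_shiftedMeasure hF g
  have hXa : AEMeasurable
      (fun w i => wienerIntegral (F i) w + ∫ s in (0 : ℝ)..1, F i s * g s) γ :=
    aemeasurable_pi_lambda _ fun i => (hγ.aemeasurable_wienerIntegral (hF i)).add_const _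
  refine Measure.ext_of_charFunDual (funext fun l => ?_)
  -- Cramér–Wold: a dual functional with coefficients `b` turns the vector into the single Wiener
  -- integral of `∑ i, b i * F i`.
  set b : Fin n → ℝ := fun i => l (Pi.single i 1) with hb
  have hl : ∀ x : Fin n → ℝ, l x = ∑ i, b i * x i := fun x => by
    conv_lhs => rw [pi_eq_sum_univ' x]
    simp [hb, mul_comm]
  have hG : MemL2 fun s => ∑ i, b i * F i s :=
    memLp_finsetSum Finset.univ fun i _ => (hF i).const_mul (b i)
  have hlin := hγ.wienerIntegral_sum Finset.univ hF b
  have hlinν := (withDensity_absolutelyContinuous γ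
    fun w => ENNReal.ofReal (expMartingale g w)).ae_le hlin
  have hint : ∫ s in (0 : ℝ)..1, (∑ i, b i * F i s) * g s
      = ∑ i, b i * ∫ s in (0 : ℝ)..1, F i s * g s := by
    simp only [Finset.sum_mul, mul_assoc]
    rw [intervalIntegral.integral_finsetSum fun i _ =>
      ((hF i).intervalIntegrable_mul hg).const_mul (b i)]
    simp only [intervalIntegral.integral_const_mul]
  have hmgf := hγ.complexMGF_shiftedMeasure hG hg Complex.I
  have hmeas : Measurable fun x : Fin n → ℝ => Complex.exp (l x * Complex.I) := by fun_prop
  rw [charFunDual_apply, charFunDual_apply, integral_map hXν hmeas.aestronglyMeasurable,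
    integral_map hXa hmeas.aestronglyMeasurable]
  have e1 : complexMGF (wienerIntegral fun s => ∑ i, b i * F i s) (shiftedMeasure γ g) Complex.I
      = ∫ w, Complex.exp (l (fun i => wienerIntegral (F i) w) * Complex.I)
        ∂(shiftedMeasure γ g) := by
    refine integral_congr_ae ?_
    filter_upwards [hlinν] with w hw
    rw [hl, hw, mul_comm]
  have e2 : complexMGF (fun w => wienerIntegral (fun s => ∑ i, b i * F i s) w
        + ∫ s in (0 : ℝ)..1, (∑ i, b i * F i s) * g s) γ Complex.I
      = ∫ w, Complex.exp (l (fun i => wienerIntegral (F i) w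
        + ∫ s in (0 : ℝ)..1, F i s * g s) * Complex.I) ∂γ := by
    refine integral_congr_ae ?_
    filter_upwards [hlin] with w hw
    rw [hl, hw, hint, mul_comm]
    simp only [mul_add, Finset.sum_add_distrib]
  rw [← e1, ← e2, hmgf]

lemma memLp_eval_wienerIntegral (hγ : IsWienerMeasure γ) (hF : ∀ i, MemL2 (F i))
    (a : Fin n → ℝ) (p : MvPolynomial (Fin n) ℝ) (q : ℝ≥0∞) (hq : q ≠ ⊤) :
    MemLp (fun w => MvPolynomial.eval (fun i => wienerIntegral (F i) w + a i) p) q γ := by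
  have := hγ.isProbabilityMeasure
  -- Multiplying by a variable uses Hölder with both factors in `L^(2q)`, so the exponent must be
  -- free in the induction.
  induction p using MvPolynomial.induction_on generalizing q with
  | C c =>
    simp only [MvPolynomial.eval_C]
    exact memLp_const c
  | add p₁ p₂ h₁ h₂ =>
    simp only [map_add]
    exact (h₁ q hq).add (h₂ q hq)
  | mul_X p i h =>
    have h2 : q * 2 ≠ ⊤ := ENNReal.mul_ne_top hq (by simp)
    have : ENNReal.HolderTriple (q * 2) (q * 2) q := ⟨by
      rw [ENNReal.mul_inv (by simp) (by simp), ← mul_add, ENNReal.inv_two_add_inv_two, mul_one]⟩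
    simp only [map_mul, MvPolynomial.eval_X]
    exact ((hγ.memLp_wienerIntegral (hF i) (q * 2) h2).add (memLp_const (a i))).mul' (h _ h2)

lemma integrable_eval_wienerIntegral (hγ : IsWienerMeasure γ) (hF : ∀ i, MemL2 (F i))
    (a : Fin n → ℝ) (p : MvPolynomial (Fin n) ℝ) :
    Integrable (fun w => MvPolynomial.eval (fun i => wienerIntegral (F i) w + a i) p) γ :=
  memLp_one_iff_integrable.1 (hγ.memLp_eval_wienerIntegral hF a p 1 (by simp))

/-- Integrability against the density is integrability under the shifted measure, which the
Cameron–Martin formula reduces to that of a polynomial in translated Wiener integrals under `γ`. -/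
lemma integrable_eval_mul_expMartingale (hγ : IsWienerMeasure γ) (hF : ∀ i, MemL2 (F i))
    (hg : MemL2 g) (p : MvPolynomial (Fin n) ℝ) :
    Integrable (fun w => MvPolynomial.eval (fun i => wienerIntegral (F i) w) p
      * expMartingale g w) γ := by
  have hp : Continuous fun x : Fin n → ℝ => MvPolynomial.eval x p := p.continuous_eval
  have hXa : AEMeasurable
      (fun w i => wienerIntegral (F i) w + ∫ s in (0 : ℝ)..1, F i s * g s) γ :=
    aemeasurable_pi_lambda _ fun i => (hγ.aemeasurable_wienerIntegral (hF i)).add_const _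
  have h := (integrable_map_measure hp.aestronglyMeasurable hXa).2
    (hγ.integrable_eval_wienerIntegral hF _ p)
  rw [← hγ.map_shiftedMeasure hF hg] at h
  exact (hγ.integrable_shiftedMeasure_iff hg _).1
    (h.comp_aemeasurable (hγ.aemeasurable_wienerIntegral_pi_shiftedMeasure hF g))

lemma integral_eval_add_eq (hγ : IsWienerMeasure γ) (hF : ∀ i, MemL2 (F i))
    (hg : MemL2 g) (p : MvPolynomial (Fin n) ℝ) :
    ∫ w, MvPolynomial.eval
        (fun i => wienerIntegral (F i) w + ∫ s in (0 : ℝ)..1, F i s * g s) p ∂γ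
      = ∫ w, MvPolynomial.eval (fun i => wienerIntegral (F i) w) p * expMartingale g w ∂γ := by
  have hp : Continuous fun x : Fin n → ℝ => MvPolynomial.eval x p := p.continuous_eval
  have hXa : AEMeasurable
      (fun w i => wienerIntegral (F i) w + ∫ s in (0 : ℝ)..1, F i s * g s) γ :=
    aemeasurable_pi_lambda _ fun i => (hγ.aemeasurable_wienerIntegral (hF i)).add_const _
  rw [← hγ.integral_shiftedMeasure hg, ← integral_map hXa hp.aestronglyMeasurable,
    ← hγ.map_shiftedMeasure hF hg, integral_map
      (hγ.aemeasurable_wienerIntegral_pi_shiftedMeasure hF g) hp.aestronglyMeasurable]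

end IsWienerMeasure

lemma IsWienerMeasure.expOp_dirDerivAdj_one_ae_eq (hγ : IsWienerMeasure γ) {θ : wienerSpace}
    (hθ : θ ∈ cameronMartin) :
    ∀ᵐ w ∂γ, expOp (dirDerivAdj θ) (fun _ => 1) w = expMartingale (pathDeriv θ) w := by
  filter_upwards [hγ.ae_bracketDeriv_eq hθ θ] with w hw
  rw [expOp, (hasSum_expTerm_dirDerivAdj_one hθ w).tsum_eq, hw, expMartingale, bracket]
  simp only [← sq]
  ring_nf

end WienerCM

end

theorem mainTheorem7 (γ : MeasureTheory.Measure WienerCM.wienerSpace)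
    (hγ : WienerCM.IsWienerMeasure γ)
    (θ : WienerCM.wienerSpace) (hθ : θ ∈ WienerCM.cameronMartin) :
    -- the pathwise `[h]` used below are versions of the Wiener integrals
    (∀ h ∈ WienerCM.cameronMartin,
      WienerCM.IsWienerIntegral γ (WienerCM.pathDeriv h) (WienerCM.bracket h)) ∧
    -- `e^{D_θ^*} 1` is well defined and is the exponential martingale
    (∀ (n : ℕ) (w : WienerCM.wienerSpace),
      WienerCM.DirDerivExists θ ((WienerCM.dirDerivAdj θ)^[n] (fun _ => 1)) w) ∧
    (∀ᵐ w ∂γ, Summable (WienerCM.expTerm (WienerCM.dirDerivAdj θ) (fun _ => 1) w) ∧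
      WienerCM.expOp (WienerCM.dirDerivAdj θ) (fun _ => 1) w =
        Real.exp (WienerCM.bracket θ w
          - 1 / 2 * ∫ t in (0 : ℝ)..1, WienerCM.pathDeriv θ t ^ 2)) ∧
    -- `E[e^{D_θ} F] = E[F · e^{D_θ^*} 1]`, all objects being well defined
    (∀ F ∈ WienerCM.polyFunctionals,
      (∀ (n : ℕ) (w : WienerCM.wienerSpace),
        WienerCM.DirDerivExists θ ((WienerCM.dirDeriv θ)^[n] F) w) ∧
      (∀ w : WienerCM.wienerSpace, Summable (WienerCM.expTerm (WienerCM.dirDeriv θ) F w)) ∧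
      MeasureTheory.Integrable (WienerCM.expOp (WienerCM.dirDeriv θ) F) γ ∧
      MeasureTheory.Integrable
        (fun w => F w * WienerCM.expOp (WienerCM.dirDerivAdj θ) (fun _ => 1) w) γ ∧
      ∫ w, WienerCM.expOp (WienerCM.dirDeriv θ) F w ∂γ =
        ∫ w, F w * WienerCM.expOp (WienerCM.dirDerivAdj θ) (fun _ => 1) w ∂γ) := by
  open WienerCM in
  refine ⟨fun h hh => hγ.isWienerIntegral_wienerIntegral hh.2,
    fun n w => dirDerivExists_iterate_dirDerivAdj_one hθ n w, ?_, ?_⟩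
  · filter_upwards [hγ.expOp_dirDerivAdj_one_ae_eq hθ] with w hw
    exact ⟨(hasSum_expTerm_dirDerivAdj_one hθ w).summable, hw⟩
  · rintro F ⟨n, h, p, hh, hF⟩
    -- The slopes here are `bracketDeriv`, valid at every `w`; they are replaced by the `L²` inner
    -- products only almost everywhere, when integrating.
    have hq : ∀ w (ε : ℝ), F (w + ε • θ)
        = (linePoly p (fun i => bracket (h i) w) fun i => bracketDeriv (h i) θ w).eval ε := by
      intro w ε
      rw [eval_linePoly, hF]
      simp only [bracket_add_smul (hh _) hθ]
    have hL : ∀ i, MemL2 (pathDeriv (h i)) := fun i => (hh i).2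
    have e1 : ∀ᵐ w ∂γ, expOp (dirDeriv θ) F w = MvPolynomial.eval
        (fun i => wienerIntegral (pathDeriv (h i)) w
          + ∫ s in (0 : ℝ)..1, pathDeriv (h i) s * pathDeriv θ s) p := by
      filter_upwards [MeasureTheory.ae_all_iff.2 fun i => hγ.ae_bracketDeriv_eq (hh i) θ]
        with w hw
      rw [expOp, (hasSum_expTerm_of_polynomial hq w).tsum_eq]
      have h1 := hq w 1
      rw [one_smul, eval_linePoly] at h1
      rw [h1]
      simp only [hw, one_mul]
      rfl
    have e2 : ∀ᵐ w ∂γ, F w * expOp (dirDerivAdj θ) (fun _ => 1) w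
        = MvPolynomial.eval (fun i => wienerIntegral (pathDeriv (h i)) w) p
          * expMartingale (pathDeriv θ) w := by
      filter_upwards [hγ.expOp_dirDerivAdj_one_ae_eq hθ] with w hw
      rw [hw, hF]
      rfl
    refine ⟨fun n w => dirDerivExists_of_polynomial hq n w,
      fun w => (hasSum_expTerm_of_polynomial hq w).summable,
      (MeasureTheory.integrable_congr e1).2 (hγ.integrable_eval_wienerIntegral hL _ p),
      (MeasureTheory.integrable_congr e2).2 (hγ.integrable_eval_mul_expMartingale hL hθ.2 p), ?_⟩
    rw [MeasureTheory.integral_congr_ae e1, MeasureTheory.integral_congr_ae e2]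
    exact hγ.integral_eval_add_eq hL hθ.2 p
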